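/- **Setting.** Let $T\in\mathbb R^{I_1\times\dots\times I_N}$ have an exact Tucker factorization $T=\llbracket G_*;A_*^{(1)},\dots,A_*^{(N)}\rrbracket$, where $G_*\in\mathbb R^{r_1\times\dots\times r_N}$ has multilinear rank $(r_1,\dots,r_N)$ and every $A_*^{(k)}\in\mathbb R^{I_k\times r_k}$ has orthonormal columns. For a tensor $S$ let $S_{(k)}$ be its mode-$k$ unfolding. $\|\cdot\|$ is the spectral norm, $\|\cdot\|_F$ the Frobenius norm, $\|\cdot\|_{2,\infty}$ the largest Euclidean norm of a row, $\sigma_{\min}$ the smallest singular value. $\Theta(X,Y)$ is the diagonal matrix of canonical angles between the column spaces of $X$ and $Y$, that is, the arccosines of the singular values of $U^{\mathrm T}V$ for orthonormal basis matrices $U,V$ of the two spaces. Fix a mode $n$ and current estimates: a core $G_{t-1}\in\mathbb R^{r_1\times\dots\times r_N}$ and factors $A_{t-1}^{(k)}$ (all $k$) and $A_t^{(k)}$ ($k<n$) in $\mathbb R^{I_k\times r_k}$, not depending on the sampling below, all with orthonormal columns. For real numbers $\mu_1,\dots,\mu_N$ assume $\|A^{(k)}\|_{2,\infty}\le\sqrt{\mu_kr_k/I_k}$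 for each of these factors. Assume $\sigma_{\min}([G_{t-1}]_{(k)})\ge g_{\min}>0$ for all $k$. Put $$J_k=\prod_{l\ne k}I_l,\quad J_{\min}=\min_kJ_k,\quad g_{\max}=\max_k\|T_{(k)}\|,\quad \sin\theta_{t-1}=\max_k\|\sin\Theta(A_{t-1}^{(k)},A_*^{(k)})\|,$$ $$M_{t,n}=A_{t-1}^{(N)}\otimes\dots\otimes A_{t-1}^{(n+1)}\otimes A_t^{(n-1)}\otimes\dots\otimes A_t^{(1)},\qquad M_{*,n}=A_*^{(N)}\otimes\dots\otimes A_*^{(n+1)}\otimes A_*^{(n-1)}\otimes\dots\otimes A_*^{(1)},$$ $$L(X)=\llbracket G_{t-1};A_t^{(1)},\dots,A_t^{(n-1)},X,A_{t-1}^{(n+1)},\dots,A_{t-1}^{(N)}\rrbracket\qquad(X\in\mathbb R^{I_n\times r_n}),$$ and assume, for a constant $C>0$, $$\|\sin\Theta(M_{t,n}[G_{t-1}]_{(n)}^{\mathrm T},\,M_{*,n}[G_*]_{(n)}^{\mathrm T})\|\le C\sin\theta_{t-1}.$$ Each entry of $T$ is observed independently with probability $p\in[4p_*,\tfrac12]$,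 where $$p_*=\tfrac{10}{3}\Bigl(\log\bigl(2\textstyle\prod_{k=1}^NI_k\bigr)+5\Bigr)\max_m\prod_{k\ne m}\frac{\mu_kr_k}{I_k}.$$ Let $\Omega$ be the set of observed indices and $\Pi_\Omega$ the operator that sets the entries outside $\Omega$ to zero. Let $\alpha\ge1$ satisfy $J_{\min}^{\log\alpha}\le(\prod_{k}I_k)^3$ (for instance any $1\le\alpha\le e^3$). **Lemma.** Let $X_{\rm opt}$ minimize $\|L(X)-T\|_F$. With probability at least $1-2/J_{\min}^{10+\log\alpha}$, every minimizer $\widetilde X_{\rm opt}$ of $\|\Pi_\Omega(L(X))-\Pi_\Omega(T)\|_F$ satisfies $$\|\widetilde X_{\rm opt}-X_{\rm opt}\|\le\frac{6g_{\max}(C_1+C_2)}{g_{\min}}\sqrt{\frac{\alpha}{p}}\,\sin\theta_{t-1},$$ where $$C_1=C\,\frac{g_{\max}}{g_{\min}}\max_m\Bigl\{\sqrt{\tfrac{7\mu_mr_m}{I_m}}\prod_{k\ne m}\sqrt{\mu_kr_k}\Bigr\},\qquad C_2=C\max_m\sqrt{\frac{\mu_mr_mJ_m}{I_m}}.$$ 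-/

import Mathlib

open scoped Matrix.Norms.L2Operator

noncomputable section

namespace TuckerALS

/-- Real tensors of order `N` and size `d 0 × ⋯ × d (N-1)`. -/
abbrev Tensor {N : ℕ} (d : Fin N → ℕ) : Type := (∀ k, Fin (d k)) → ℝ

/-- Multi-indices with the mode-`n` index removed. -/
abbrev CoIndex {N : ℕ} (d : Fin N → ℕ) (n : Fin N) : Type := ∀ k : {k : Fin N // k ≠ n}, Fin (d k)

/-- Mode-`n` unfolding: the columns are the mode-`n` fibers, labelled by the remaining indices. -/
def unfold {N : ℕ} {d : Fin N → ℕ} (n : Fin N) (T : Tensor d) :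
    Matrix (Fin (d n)) (CoIndex d n) ℝ :=
  Matrix.of fun i j => T ((Equiv.piSplitAt n fun k => Fin (d k)).symm (i, j))

/-- The multilinear product `⟦G; B⁽¹⁾, …, B⁽ᴺ⁾⟧`. -/
def multiProd {N : ℕ} {d r : Fin N → ℕ} (G : Tensor r)
    (B : ∀ k, Matrix (Fin (d k)) (Fin (r k)) ℝ) : Tensor d :=
  fun i => ∑ s : ∀ k, Fin (r k), G s * ∏ k, B k (i k) (s k)

/-- Frobenius norm of a tensor. -/
def frobNorm {N : ℕ} {d : Fin N → ℕ} (T : Tensor d) : ℝ := √(∑ i, T i ^ 2)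

open Classical in
/-- `Π_S`: keep the entries with index in `S`, put zero elsewhere. -/
def proj {N : ℕ} {d : Fin N → ℕ} (S : Set (∀ k, Fin (d k))) (T : Tensor d) : Tensor d :=
  fun i => if i ∈ S then T i else 0

/-- The Kronecker product of all `B⁽ᵏ⁾` with `k ≠ n` (rows and columns labelled by the indices
with the mode-`n` index removed, in accordance with `unfold`). -/
def kronExcept {N : ℕ} {d r : Fin N → ℕ} (n : Fin N)
    (B : ∀ k, Matrix (Fin (d k)) (Fin (r k)) ℝ) : Matrix (CoIndex d n) (CoIndex r n) ℝ :=
  Matrix.of fun j s => ∏ k, B k.1 (j k) (s k)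

/-- The factors in use when mode `n` is updated: new ones for the modes before `n`, old ones for
the modes after `n` (the entry at `n` itself is never used). -/
def mixed {N : ℕ} {d r : Fin N → ℕ} (n : Fin N)
    (Aold Anew : ∀ k, Matrix (Fin (d k)) (Fin (r k)) ℝ) :
    ∀ k, Matrix (Fin (d k)) (Fin (r k)) ℝ :=
  fun k => if k < n then Anew k else Aold k

/-- The tensor `L(X)`, with `X` in place of the `n`-th factor. -/
def lsTensor {N : ℕ} {d r : Fin N → ℕ} (n : Fin N) (G : Tensor r)
    (Aold Anew : ∀ k, Matrix (Fin (d k)) (Fin (r k)) ℝ) (X : Matrix (Fin (d n)) (Fin (r n)) ℝ) :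
    Tensor d :=
  multiProd G (Function.update (mixed n Aold Anew) n X)

/-- Column space. -/
def colSpace {m n : Type*} [Fintype m] [Fintype n] [DecidableEq n]
    (A : Matrix m n ℝ) : Submodule ℝ (EuclideanSpace ℝ m) :=
  LinearMap.range (Matrix.toEuclideanLin A)

/-- The map `Y → X` obtained by projecting a vector of `Y` orthogonally to `X`. With respect to
orthonormal bases of `X` and `Y` (as columns of matrices `U`, `V`) its matrix is `Uᵀ V`. -/
def crossMap {E : Type*} [NormedAddCommGroup E] [InnerProductSpace ℝ E] [FiniteDimensional ℝ E]
    (X Y : Submodule ℝ E) : Y →ₗ[ℝ] X :=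
  X.orthogonalProjectionOnto.toLinearMap ∘ₗ Y.subtype

/-- Canonical angles between two subspaces of the same dimension `k`: the arccosines of the `k`
singular values of `Uᵀ V`. -/
def canonicalAngle {E : Type*} [NormedAddCommGroup E] [InnerProductSpace ℝ E]
    [FiniteDimensional ℝ E] (X Y : Submodule ℝ E) (j : Fin (Module.finrank ℝ X)) : ℝ :=
  Real.arccos ((crossMap X Y).singularValues j)

/-- `‖sin Θ(A, B)‖` for matrices, i.e. for their column spaces: the spectral norm of the diagonal
matrix of the sines of the canonical angles. -/
def sinThetaNorm {m n n' : Type*} [Fintype m] [Fintype n] [DecidableEq n] [Fintype n']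
    [DecidableEq n'] (A : Matrix m n ℝ) (B : Matrix m n' ℝ) : ℝ :=
  ‖Matrix.diagonal fun j => Real.sin (canonicalAngle (colSpace A) (colSpace B) j)‖

/-- The smallest of the `min (#rows) (#columns)` singular values. -/
def sigmaMin {m n : Type*} [Fintype m] [Fintype n] [DecidableEq n] (A : Matrix m n ℝ) : ℝ :=
  (Matrix.toEuclideanLin A).singularValues (min (Fintype.card m) (Fintype.card n) - 1)

/-- `‖A‖_{2,∞}`: the largest Euclidean norm of a row. -/
def twoInfNorm {m n : Type*} [Fintype n] (A : Matrix m n ℝ) : ℝ := ⨆ i, √(∑ j, A i j ^ 2)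

/-- `J_n = ∏_{k ≠ n} I_k`. -/
def coSize {N : ℕ} (d : Fin N → ℕ) (n : Fin N) : ℝ := ∏ k ∈ Finset.univ.erase n, (d k : ℝ)

/-- `J_min = min_k J_k`. -/
def coSizeMin {N : ℕ} (d : Fin N → ℕ) : ℝ := ⨅ k, coSize d k

/-- `g_max = max_k ‖T_(k)‖` (spectral norms). -/
def gMax {N : ℕ} {d : Fin N → ℕ} (T : Tensor d) : ℝ := ⨆ k, ‖unfold k T‖

/-- `sin θ = max_k ‖sin Θ(A⁽ᵏ⁾, B⁽ᵏ⁾)‖`. -/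
def maxSin {N : ℕ} {d r : Fin N → ℕ} (A B : ∀ k, Matrix (Fin (d k)) (Fin (r k)) ℝ) : ℝ :=
  ⨆ k, sinThetaNorm (A k) (B k)

/-- `p_* = (10/3) (log (2 ∏_k I_k) + 5) max_n ∏_{k ≠ n} μ_k r_k / I_k`. -/
def pStar {N : ℕ} (d r : Fin N → ℕ) (μ : Fin N → ℝ) : ℝ :=
  10 / 3 * (Real.log (2 * ∏ k, (d k : ℝ)) + 5) *
    ⨆ n, ∏ k ∈ Finset.univ.erase n, μ k * r k / d k

/-- `C₁ = C (g_max / g_min) max_n { √(7 μ_n r_n / I_n) ∏_{k ≠ n} √(μ_k r_k) }`. -/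
def constOne {N : ℕ} (d r : Fin N → ℕ) (μ : Fin N → ℝ) (C gmax gmin : ℝ) : ℝ :=
  C * (gmax / gmin) *
    ⨆ n, √(7 * μ n * r n / d n) * ∏ k ∈ Finset.univ.erase n, √(μ k * r k)

/-- `C₂ = C max_n √(μ_n r_n J_n / I_n)`. -/
def constTwo {N : ℕ} (d r : Fin N → ℕ) (μ : Fin N → ℝ) (C : ℝ) : ℝ :=
  C * ⨆ n, √(μ n * r n * coSize d n / d n)

end TuckerALS

end

/-! In the mode-`n` unfolding, `L(X)` becomes `X Wᵀ` and `T` becomes `A_* Vᵀ`, where `W` and `V` are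
the two matrices of the angle condition and `A_*` is the true `n`-th factor. Both least-squares
problems therefore split over rows.

Deterministic part. Every column of `V` is approximated from the column space of `W` up to the sine
of the largest angle, so the full residual is at most `√r_n · g_max · ‖sin Θ(W, V)‖`
(`leastSquares_residual_le`). Minimality along the line through `X_opt` and a sampled minimizer
bounds the sampled energy of their difference by the residual of `X_opt`
(`sampled_leastSquares_le`). If sampling keeps at least the fraction `τ = p/(36α)` of the energy of
`W x` in every row, then `|W x| ≥ g_min |x|` gives the bound `6 g_max √r_n √(α/p) ‖sin Θ‖ / g_min`.
Finally `√r_n` is at most the maximum in `C₂` (`sqrt_le_iSup_sqrt`); `C₁` is only an added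
nonnegative term.

Random part. An orthonormal basis of the column space of `W` has rows of squared length at most `ν =
∏_{k≠n} μ_k r_k / I_k`, so the matrix Chernoff bound (`sum_weight_gram_lt_le`) controls the loss of
energy in one row, and a union bound covers all `I_n` rows. The Chernoff bound rests on the
Golden–Thompson inequality, which follows from trace inequalities for powers of two and the
Lie–Trotter formula. -/

namespace TuckerALS

/-! ### Trace inequalities for powers of two. -/

section TracePower

variable {m : Type*} [Fintype m]

open Matrix

theorem trace_transpose_mul_self_nonneg (A : Matrix m m ℝ) : 0 ≤ (Aᵀ * A).trace := by
  simp only [Matrix.trace, Matrix.diag, Matrix.mul_apply, Matrix.transpose_apply]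
  exact Finset.sum_nonneg fun i _ => Finset.sum_nonneg fun j _ => mul_self_nonneg _

/-- The arithmetic-geometric form of the Cauchy–Schwarz inequality for the trace form. -/
theorem two_mul_trace_mul_le (A B : Matrix m m ℝ) :
    2 * (A * B).trace ≤ (Aᵀ * A).trace + (Bᵀ * B).trace := by
  have h := trace_transpose_mul_self_nonneg (A - Bᵀ)
  have h1 : ((A - Bᵀ)ᵀ * (A - Bᵀ)).trace
      = (Aᵀ * A).trace + (Bᵀ * B).trace - 2 * (A * B).trace := by
    have e1 : (Aᵀ * Bᵀ).trace = (A * B).trace := by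
      rw [← Matrix.transpose_mul, Matrix.trace_transpose, Matrix.trace_mul_comm]
    simp only [Matrix.transpose_sub, Matrix.transpose_transpose, Matrix.sub_mul, Matrix.mul_sub,
      Matrix.trace_sub, e1, Matrix.trace_mul_comm B A, Matrix.trace_mul_comm B Bᵀ]
    ring
  linarith

variable [DecidableEq m]

theorem trace_mul_pow_comm (A B : Matrix m m ℝ) (k : ℕ) :
    ((A * B) ^ k).trace = ((B * A) ^ k).trace := by
  cases k with
  | zero => simp
  | succ k =>
    have : (A * B) ^ (k + 1) = A * ((B * A) ^ k * B) := by
      induction k with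
      | zero => simp
      | succ k ih => rw [pow_succ', ih, pow_succ' (B * A)]; simp only [Matrix.mul_assoc]
    rw [this, Matrix.trace_mul_comm, Matrix.mul_assoc, ← pow_succ]

theorem isSymm_pow {A : Matrix m m ℝ} (h : Aᵀ = A) (k : ℕ) : (A ^ k)ᵀ = A ^ k := by
  rw [Matrix.transpose_pow, h]

/-- Weyl-type and Lieb–Thirring-type trace inequalities for powers of two. -/
theorem trace_pow_two_pow_le (k : ℕ) :
    (∀ A : Matrix m m ℝ, (A ^ 2 ^ (k + 1)).trace ≤ ((Aᵀ * A) ^ 2 ^ k).trace) ∧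
    (∀ P Q : Matrix m m ℝ, Pᵀ = P → Qᵀ = Q →
      ((P * Q) ^ 2 ^ k).trace ≤ (P ^ 2 ^ k * Q ^ 2 ^ k).trace) := by
  -- The two claims go together: each of them at `k + 1` uses both at `k`. Restricting to powers of
  -- two lets symmetry of `P` and `Q` suffice, without positivity.
  induction k with
  | zero =>
    refine ⟨fun A => ?_, fun P Q _ _ => by simp⟩
    have := two_mul_trace_mul_le A A
    simp only [zero_add, pow_one, pow_zero, sq]
    linarith
  | succ k ih =>
    obtain ⟨ih1, ih2⟩ := ih
    have hP : ∀ A : Matrix m m ℝ, (A ^ 2 ^ (k + 1 + 1)).trace ≤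
        ((Aᵀ * A) ^ 2 ^ (k + 1)).trace := by
      intro A
      have s1 : (Aᵀ * A)ᵀ = Aᵀ * A := by simp
      have s2 : (A * Aᵀ)ᵀ = A * Aᵀ := by simp
      calc (A ^ 2 ^ (k + 1 + 1)).trace = ((A ^ 2) ^ 2 ^ (k + 1)).trace := by
            rw [← pow_mul]; congr 2; ring
        _ ≤ (((A ^ 2)ᵀ * A ^ 2) ^ 2 ^ k).trace := ih1 _
        _ = ((Aᵀ * (Aᵀ * A * A)) ^ 2 ^ k).trace := by
            congr 2; simp only [sq, Matrix.transpose_mul, Matrix.mul_assoc]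
        _ = ((Aᵀ * A * (A * Aᵀ)) ^ 2 ^ k).trace := by
            rw [trace_mul_pow_comm]; simp only [Matrix.mul_assoc]
        _ ≤ ((Aᵀ * A) ^ 2 ^ k * (A * Aᵀ) ^ 2 ^ k).trace := ih2 _ _ s1 s2
        _ ≤ ((Aᵀ * A) ^ 2 ^ (k + 1)).trace := by
            have := two_mul_trace_mul_le ((Aᵀ * A) ^ 2 ^ k) ((A * Aᵀ) ^ 2 ^ k)
            rw [isSymm_pow s1, isSymm_pow s2, ← pow_add, ← pow_add,
              trace_mul_pow_comm A Aᵀ] at this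
            have e : 2 ^ k + 2 ^ k = 2 ^ (k + 1) := by ring
            rw [e] at this
            linarith
    refine ⟨hP, fun P Q hPs hQs => ?_⟩
    have t1 : (P ^ 2)ᵀ = P ^ 2 := isSymm_pow hPs 2
    have t2 : (Q ^ 2)ᵀ = Q ^ 2 := isSymm_pow hQs 2
    calc ((P * Q) ^ 2 ^ (k + 1)).trace ≤ (((P * Q)ᵀ * (P * Q)) ^ 2 ^ k).trace := ih1 _
      _ = ((Q * (P ^ 2 * Q)) ^ 2 ^ k).trace := by
          congr 2; rw [Matrix.transpose_mul, hPs, hQs]; simp only [sq, Matrix.mul_assoc]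
      _ = ((P ^ 2 * Q ^ 2) ^ 2 ^ k).trace := by
          rw [trace_mul_pow_comm]; simp only [sq, Matrix.mul_assoc]
      _ ≤ ((P ^ 2) ^ 2 ^ k * (Q ^ 2) ^ 2 ^ k).trace := ih2 _ _ t1 t2
      _ = (P ^ 2 ^ (k + 1) * Q ^ 2 ^ (k + 1)).trace := by
          rw [← pow_mul, ← pow_mul, pow_succ']

end TracePower

/-! ### The Lie–Trotter formula. -/

section LieTrotter

variable {𝔸 : Type*} [NormedRing 𝔸] [NormOneClass 𝔸]

open NormedSpace Filter Topology

theorem norm_exp_le_exp_norm [NormedAlgebra ℝ 𝔸] [CompleteSpace 𝔸] (x : 𝔸) : ‖exp x‖ ≤ Real.exp ‖x‖ := by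
  have h1 : HasSum (fun n : ℕ => ((n.factorial : ℝ)⁻¹) • x ^ n) (exp x) := exp_series_hasSum_exp' (𝕂 := ℝ) x
  have h2 : HasSum (fun n : ℕ => ((n.factorial : ℝ)⁻¹) • ‖x‖ ^ n) (exp ‖x‖) :=
    exp_series_hasSum_exp' (𝕂 := ℝ) ‖x‖
  rw [Real.exp_eq_exp_ℝ, ← h1.tsum_eq]
  refine tsum_of_norm_bounded h2 fun n => ?_
  rw [norm_smul, smul_eq_mul, norm_inv, Real.norm_natCast]
  gcongr
  exact norm_pow_le x n

theorem norm_pow_sub_pow_le (x y : 𝔸) (K : ℝ) (hx : ‖x‖ ≤ K) (hy : ‖y‖ ≤ K) (n : ℕ) :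
    ‖x ^ (n + 1) - y ^ (n + 1)‖ ≤ (n + 1) * ‖x - y‖ * K ^ n := by
  have hK : 0 ≤ K := (norm_nonneg _).trans hx
  induction n with
  | zero => simp
  | succ n ih =>
    have e : x ^ (n + 1 + 1) - y ^ (n + 1 + 1)
        = (x ^ (n + 1) - y ^ (n + 1)) * x + y ^ (n + 1) * (x - y) := by
      rw [pow_succ x, pow_succ y]; noncomm_ring
    rw [e]
    calc _ ≤ ‖x ^ (n + 1) - y ^ (n + 1)‖ * ‖x‖ + ‖y ^ (n + 1)‖ * ‖x - y‖ :=
          (norm_add_le _ _).trans (add_le_add (norm_mul_le _ _) (norm_mul_le _ _))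
      _ ≤ ((n + 1) * ‖x - y‖ * K ^ n) * K + K ^ (n + 1) * ‖x - y‖ := by
          gcongr
          exact (norm_pow_le y _).trans (pow_le_pow_left₀ (norm_nonneg _) hy _)
      _ = _ := by push_cast; ring

/-- The **Lie–Trotter product formula** along powers of two. -/
theorem tendsto_exp_mul_exp_pow [NormedAlgebra ℝ 𝔸] [CompleteSpace 𝔸] (a b : 𝔸) :
    Tendsto (fun k : ℕ => (exp (((2 : ℝ) ^ k)⁻¹ • a) * exp (((2 : ℝ) ^ k)⁻¹ • b)) ^ 2 ^ k)
      atTop (𝓝 (exp (a + b))) := by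
  -- `f` and its derivative vanish at `0`, so `2^k ‖f(2^{-k})‖ → 0`. Telescoping the `2^k`-th powers
  -- costs only the factor `2^k e^R`.
  set f : ℝ → 𝔸 := fun t => exp (t • a) * exp (t • b) - exp (t • (a + b)) with hf
  have hd : HasDerivAt f 0 0 := by
    have h (c : 𝔸) : HasDerivAt (fun t : ℝ => exp (t • c)) c 0 := by
      simpa using hasDerivAt_exp_smul_const (𝕂 := ℝ) c (0 : ℝ)
    have h3 := ((h a).mul (h b)).sub (h (a + b))
    simp only [zero_smul, exp_zero, mul_one, one_mul, sub_self] at h3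
    exact h3
  have hu : Tendsto (fun k : ℕ => ((2 : ℝ) ^ k)⁻¹) atTop (𝓝 0) := by
    exact tendsto_inv_atTop_zero.comp (tendsto_pow_atTop_atTop_of_one_lt (one_lt_two (α := ℝ)))
  have hlim : Tendsto (fun k : ℕ => (2 : ℝ) ^ k * ‖f (((2 : ℝ) ^ k)⁻¹)‖) atTop (𝓝 0) := by
    have ho := (hasDerivAt_iff_isLittleO.1 hd).comp_tendsto hu
    have f0 : f 0 = 0 := by simp [hf]
    have := ho.norm_left.tendsto_div_nhds_zero
    simpa [Function.comp_def, f0, mul_comm, div_eq_mul_inv] using this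
  rw [tendsto_iff_norm_sub_tendsto_zero]
  set R := ‖a‖ + ‖b‖
  have hlim2 := hlim.mul_const (Real.exp R)
  rw [zero_mul] at hlim2
  refine squeeze_zero (fun _ => norm_nonneg _) (fun k => ?_) hlim2
  set t : ℝ := ((2 : ℝ) ^ k)⁻¹ with ht
  have ht0 : 0 < t := by positivity
  have hexp : exp (a + b) = exp (t • (a + b)) ^ 2 ^ k := by
    let _ := NormedAlgebra.restrictScalars ℚ ℝ 𝔸
    rw [← exp_nsmul, ← Nat.cast_smul_eq_nsmul ℝ, smul_smul, ht]
    simp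
  have hK1 : ‖exp (t • a) * exp (t • b)‖ ≤ Real.exp (t * R) := by
    refine (norm_mul_le _ _).trans ?_
    rw [mul_add, Real.exp_add]
    gcongr
    · exact (norm_exp_le_exp_norm _).trans_eq (by rw [norm_smul, Real.norm_of_nonneg ht0.le])
    · exact (norm_exp_le_exp_norm _).trans_eq (by rw [norm_smul, Real.norm_of_nonneg ht0.le])
  have hK2 : ‖exp (t • (a + b))‖ ≤ Real.exp (t * R) := by
    refine (norm_exp_le_exp_norm _).trans ?_
    rw [norm_smul, Real.norm_of_nonneg ht0.le]
    gcongr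
    exact norm_add_le _ _
  obtain ⟨n, hn⟩ : ∃ n, 2 ^ k = n + 1 := Nat.exists_eq_succ_of_ne_zero (by positivity)
  have hn' : (2 : ℝ) ^ k = n + 1 := by exact_mod_cast hn
  rw [hexp, hn, hn']
  refine (norm_pow_sub_pow_le _ _ _ hK1 hK2 n).trans ?_
  rw [← hn']
  rw [show ‖f t‖ = ‖exp (t • a) * exp (t • b) - exp (t • (a + b))‖ from rfl]
  gcongr
  rw [← Real.exp_nat_mul, Real.exp_le_exp]
  have : (n : ℝ) * t ≤ 1 := by
    rw [ht, hn', ← div_eq_mul_inv, div_le_one (by positivity)]; linarith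
  have hR : 0 ≤ R := by positivity
  nlinarith

end LieTrotter

/-! ### The Golden–Thompson inequality. -/

section GoldenThompson

variable {m : Type*} [Fintype m] [DecidableEq m]

open Matrix NormedSpace Filter Topology

/-- The **Golden–Thompson inequality** for real symmetric matrices. -/
theorem trace_exp_add_le {A B : Matrix m m ℝ} (hA : Aᵀ = A) (hB : Bᵀ = B) :
    (exp (A + B)).trace ≤ (exp A * exp B).trace := by
  -- The product formula needs `‖1‖ = 1`, which fails for the empty matrix.
  cases isEmpty_or_nonempty m with
  | inl h => simp [Matrix.trace]
  | inr h =>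
    have hlim := tendsto_exp_mul_exp_pow A B
    have hc : Continuous (fun M : Matrix m m ℝ => M.trace) := continuous_id.matrix_trace
    refine le_of_tendsto ((hc.tendsto _).comp hlim) (Eventually.of_forall fun k => ?_)
    have hs (C : Matrix m m ℝ) (hC : Cᵀ = C) (t : ℝ) : (exp (t • C))ᵀ = exp (t • C) := by
      rw [← Matrix.exp_transpose, Matrix.transpose_smul, hC]
    have hp (C : Matrix m m ℝ) : exp (((2 : ℝ) ^ k)⁻¹ • C) ^ 2 ^ k = exp C := by
      rw [← Matrix.exp_nsmul, ← Nat.cast_smul_eq_nsmul ℝ, smul_smul]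
      simp
    -- For `e^{A/2^k}` and `e^{B/2^k}` the upper bound is `tr (e^A e^B)` for every `k`, so it
    -- survives the limit.
    have := (trace_pow_two_pow_le k).2 _ _ (hs A hA ((2 : ℝ) ^ k)⁻¹) (hs B hB ((2 : ℝ) ^ k)⁻¹)
    simpa only [Function.comp, hp] using this

end GoldenThompson

/-! ### Matrix Laplace transform and Chernoff bound. -/

section MatrixChernoff

variable {m : Type*} [Fintype m] [DecidableEq m]

open Matrix NormedSpace

/-- A real symmetric matrix whose quadratic form exceeds `b` somewhere has an exponential of
trace at least `e ^ b`. -/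
theorem exp_le_trace_exp {B : Matrix m m ℝ} (hB : Bᵀ = B) {b : ℝ} {y : m → ℝ} (hy : y ≠ 0)
    (h : b * (y ⬝ᵥ y) ≤ y ⬝ᵥ B *ᵥ y) : Real.exp b ≤ (exp B).trace := by
  have hH : B.IsHermitian := by
    rw [Matrix.IsHermitian, Matrix.conjTranspose_eq_transpose_of_trivial, hB]
  set V : Matrix m m ℝ := (hH.eigenvectorUnitary : Matrix m m ℝ) with hV
  have hVV : Vᵀ * V = 1 := by
    have := Unitary.coe_star_mul_self hH.eigenvectorUnitary
    rwa [Matrix.star_eq_conjTranspose, Matrix.conjTranspose_eq_transpose_of_trivial] at this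
  have hVV' : V * Vᵀ = 1 := mul_eq_one_comm.1 hVV
  have hinv : V⁻¹ = Vᵀ := Matrix.inv_eq_left_inv hVV
  have hBV : B = V * diagonal hH.eigenvalues * Vᵀ := by
    have := hH.spectral_theorem
    rw [Unitary.conjStarAlgAut_apply, Matrix.star_eq_conjTranspose,
      Matrix.conjTranspose_eq_transpose_of_trivial] at this
    exact this
  have htr : (exp B).trace = ∑ i, Real.exp (hH.eigenvalues i) := by
    have hu : IsUnit V := IsUnit.of_mul_eq_one _ hVV'
    conv_lhs => rw [hBV, ← hinv, Matrix.exp_conj _ _ hu, Matrix.trace_mul_comm, ← Matrix.mul_assoc,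
      hinv, hVV, Matrix.one_mul, Matrix.exp_diagonal, Matrix.trace_diagonal]
    simp [Pi.coe_exp, Real.exp_eq_exp_ℝ]
  rw [htr]
  by_contra! hlt
  -- Each `e^{λ_i}` is at most the trace, hence below `e^b`; then the quadratic form stays strictly
  -- below `b |y|²`.
  have hall : ∀ i, hH.eigenvalues i < b := fun i => by
    have h1 := Finset.single_le_sum (f := fun i => Real.exp (hH.eigenvalues i))
      (fun i _ => (Real.exp_pos _).le) (Finset.mem_univ i)
    exact Real.exp_lt_exp.1 (h1.trans_lt hlt)
  set z := Vᵀ *ᵥ y with hz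
  have hyz : y = V *ᵥ z := by rw [hz, Matrix.mulVec_mulVec, hVV', Matrix.one_mulVec]
  have e1 : y ⬝ᵥ y = ∑ i, z i * z i := by
    have : z ⬝ᵥ z = y ⬝ᵥ y := by
      rw [hz, Matrix.dotProduct_mulVec, Matrix.vecMul_transpose, ← hz, ← hyz]
    rw [← this]; rfl
  have e2 : y ⬝ᵥ B *ᵥ y = ∑ i, hH.eigenvalues i * (z i * z i) := by
    have : B *ᵥ y = V *ᵥ (diagonal hH.eigenvalues *ᵥ z) := by
      conv_lhs => rw [hBV]
      rw [hz, Matrix.mulVec_mulVec, Matrix.mulVec_mulVec, Matrix.mul_assoc]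
    rw [this, Matrix.dotProduct_mulVec, ← Matrix.mulVec_transpose, ← hz]
    simp only [dotProduct, Matrix.mulVec_diagonal]
    exact Finset.sum_congr rfl fun i _ => by ring
  have hz0 : z ≠ 0 := fun h0 => hy (by rw [hyz, h0, Matrix.mulVec_zero])
  obtain ⟨i, hi⟩ := Function.ne_iff.1 hz0
  rw [e1, e2, Finset.mul_sum] at h
  refine absurd h (not_le.2 (Finset.sum_lt_sum (fun j _ => ?_) ⟨i, Finset.mem_univ i, ?_⟩))
  · exact mul_le_mul_of_nonneg_right (hall j).le (mul_self_nonneg _)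
  · exact mul_lt_mul_of_pos_right (hall i) (mul_self_pos.2 hi)

theorem vecMulVec_self_transpose {m : Type*} (u : m → ℝ) : (vecMulVec u u)ᵀ = vecMulVec u u := by
  ext i j; simp [vecMulVec_apply, mul_comm]

/-- All powers of `V = u uᵀ` are explicit because `V² = (u·u) V`. The factor `u·u` on both sides
avoids a division and so includes `u = 0`. -/
theorem smul_exp_smul_vecMulVec (u : m → ℝ) (a : ℝ) :
    (u ⬝ᵥ u) • exp (a • vecMulVec u u)
      = (u ⬝ᵥ u) • (1 : Matrix m m ℝ) + (Real.exp (a * (u ⬝ᵥ u)) - 1) • vecMulVec u u := by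
  set s := u ⬝ᵥ u
  set V := vecMulVec u u
  have hVV : V * V = s • V := by
    rw [vecMulVec_mul_vecMulVec]
    ext i j
    simp only [V, s, vecMulVec_apply, Pi.smul_apply, Matrix.smul_apply, smul_eq_mul]
    ring
  have hpow : ∀ n : ℕ, s • (a • V) ^ n
      = (a * s) ^ n • V + if n = 0 then s • (1 : Matrix m m ℝ) - V else 0 := by
    intro n
    induction n with
    | zero => simp
    | succ n ih =>
      rw [pow_succ, ← smul_mul_assoc, ih]
      rcases Nat.eq_zero_or_pos n with rfl | hn
      · simp [smul_smul]
      · simp only [hn.ne', if_false, add_zero, Nat.succ_ne_zero, smul_mul_smul_comm, hVV, smul_smul]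
        congr 1; ring
  have h1 : HasSum (fun n : ℕ => ((n.factorial : ℝ)⁻¹) • (a • V) ^ n) (exp (a • V)) :=
    exp_series_hasSum_exp' (𝕂 := ℝ) _
  have h2 : HasSum (fun n : ℕ => ((n.factorial : ℝ)⁻¹) • (a * s) ^ n) (exp (a * s)) :=
    exp_series_hasSum_exp' (𝕂 := ℝ) _
  rw [← Real.exp_eq_exp_ℝ] at h2
  have h3 := h1.const_smul s
  have h4 := (h2.smul_const V).add (hasSum_ite_eq (0 : ℕ) (s • (1 : Matrix m m ℝ) - V))
  have h5 : (fun n : ℕ => s • ((n.factorial : ℝ)⁻¹) • (a • V) ^ n) = fun n : ℕ =>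
      (((n.factorial : ℝ)⁻¹) • (a * s) ^ n) • V
        + if n = 0 then s • (1 : Matrix m m ℝ) - V else 0 := by
    funext n
    rw [smul_comm, hpow, smul_add, smul_assoc]
    congr 1
    split_ifs with hn
    · simp [hn]
    · simp
  rw [h5] at h3
  rw [h3.unique h4, sub_smul, one_smul]
  abel

/-- With the symmetric square root `F = exp (D/2)` the trace equals `|F u|²`. -/
theorem trace_exp_mul_vecMulVec_nonneg {D : Matrix m m ℝ} (hD : Dᵀ = D) (u : m → ℝ) :
    0 ≤ (exp D * vecMulVec u u).trace := by
  set F := exp ((2 : ℝ)⁻¹ • D) with hF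
  have hFs : Fᵀ = F := by rw [hF, ← Matrix.exp_transpose, Matrix.transpose_smul, hD]
  have hFF : exp D = F * F := by
    rw [hF, ← Matrix.exp_add_of_commute _ _ (Commute.refl _), ← add_smul]
    norm_num
  rw [hFF, ← Matrix.trace_mul_cycle, Matrix.mul_vecMulVec, Matrix.vecMulVec_mul, trace_vecMulVec,
    ← hFs, Matrix.vecMul_transpose, hFs]
  exact Finset.sum_nonneg fun i _ => mul_self_nonneg _

/-- On `[0, ν]` the convex function `e^{-θs}` lies below its chord, whose slope gives the
compensator `c = p(1 - e^{-θν})/ν`; then `1 - x ≤ e^{-x}`. -/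
theorem bernoulli_laplace_le {p θ ν s : ℝ} (hp0 : 0 ≤ p) (hν : 0 < ν) (hs0 : 0 ≤ s)
    (hs : s ≤ ν) :
    p * Real.exp ((p * (1 - Real.exp (-(θ * ν))) / ν - θ) * s)
      + (1 - p) * Real.exp ((p * (1 - Real.exp (-(θ * ν))) / ν) * s) ≤ 1 := by
  set c := p * (1 - Real.exp (-(θ * ν))) / ν with hc
  have hconv : Real.exp (-(θ * s)) ≤ 1 - s / ν + s / ν * Real.exp (-(θ * ν)) := by
    have h1 : s / ν ≤ 1 := (div_le_one hν).2 hs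
    have := convexOn_exp.2 (Set.mem_univ 0) (Set.mem_univ (-(θ * ν)))
      (sub_nonneg.2 h1) (by positivity : 0 ≤ s / ν) (by ring)
    simp only [smul_eq_mul, mul_zero, zero_add, Real.exp_zero, mul_one] at this
    have e : s / ν * -(θ * ν) = -(θ * s) := by field_simp
    rwa [e] at this
  have hcs : c * s ≤ p * (1 - Real.exp (-(θ * s))) := by
    have : c * s = p * (s / ν * (1 - Real.exp (-(θ * ν)))) := by rw [hc]; ring
    rw [this]
    apply mul_le_mul_of_nonneg_left _ hp0
    linarith
  have h1 : 1 - p * (1 - Real.exp (-(θ * s))) ≤ Real.exp (-(c * s)) := by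
    have := Real.add_one_le_exp (-(c * s))
    linarith
  calc _ = Real.exp (c * s) * (1 - p * (1 - Real.exp (-(θ * s)))) := by
        rw [show (c - θ) * s = c * s + -(θ * s) by ring, Real.exp_add]; ring
    _ ≤ Real.exp (c * s) * Real.exp (-(c * s)) := by gcongr
    _ = 1 := by rw [← Real.exp_add]; simp

/-- One step of the matrix Laplace transform: a Bernoulli multiple of a rank-one matrix, compensated
by a multiple of that matrix, does not increase the trace exponential. -/
theorem trace_exp_step {D : Matrix m m ℝ} (hD : Dᵀ = D) {p θ ν : ℝ} (hp0 : 0 ≤ p) (hp1 : p ≤ 1)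
    (hν : 0 < ν) (u : m → ℝ) (hu : u ⬝ᵥ u ≤ ν) :
    p * (exp (D + (p * (1 - Real.exp (-(θ * ν))) / ν - θ) • vecMulVec u u)).trace
      + (1 - p) * (exp (D + (p * (1 - Real.exp (-(θ * ν))) / ν) • vecMulVec u u)).trace
      ≤ (exp D).trace := by
  set c := p * (1 - Real.exp (-(θ * ν))) / ν with hc
  set V := vecMulVec u u with hV
  rcases eq_or_ne u 0 with rfl | hu0
  · simp only [hV, zero_vecMulVec, smul_zero, add_zero]
    linarith
  have hs : 0 < u ⬝ᵥ u := by
    obtain ⟨i, hi⟩ := Function.ne_iff.1 hu0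
    exact Finset.sum_pos' (fun i _ => mul_self_nonneg _) ⟨i, Finset.mem_univ i, mul_self_pos.2 hi⟩
  have hVs (a : ℝ) : (a • V)ᵀ = a • V := by
    rw [Matrix.transpose_smul, vecMulVec_self_transpose]
  -- Golden–Thompson splits off `exp (a V)`, which is affine in `V`. Averaging over the Bernoulli
  -- variable then leaves a scalar coefficient, which `bernoulli_laplace_le` makes nonpositive.
  have key (a : ℝ) : (u ⬝ᵥ u) * (exp (D + a • V)).trace ≤ (u ⬝ᵥ u) * (exp D).trace
      + (Real.exp (a * (u ⬝ᵥ u)) - 1) * (exp D * V).trace := by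
    refine (mul_le_mul_of_nonneg_left (trace_exp_add_le hD (hVs a)) hs.le).trans_eq ?_
    rw [← smul_eq_mul (u ⬝ᵥ u), ← Matrix.trace_smul, ← Matrix.mul_smul, smul_exp_smul_vecMulVec]
    simp [Matrix.mul_add, hV]
  have h1 := mul_le_mul_of_nonneg_left (key (c - θ)) hp0
  have h2 := mul_le_mul_of_nonneg_left (key c) (sub_nonneg.2 hp1)
  have h3 := bernoulli_laplace_le (θ := θ) hp0 hν hs.le hu
  rw [← hc] at h3
  have h4 := mul_le_mul_of_nonneg_right h3 (trace_exp_mul_vecMulVec_nonneg hD u)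
  refine le_of_mul_le_mul_left ?_ hs
  linarith

variable {ι : Type*} [DecidableEq ι]

/-- The weighted sum is an expectation over Bernoulli samples of `t`. Letting `D` vary makes the
induction work: the decision on the new element `a` adds `(c - θ) V_a` or `c V_a` to `D`. -/
theorem sum_powerset_trace_exp_le {p θ ν : ℝ} (hp0 : 0 ≤ p) (hp1 : p ≤ 1)
    (hν : 0 < ν) (u : ι → m → ℝ) (hu : ∀ j, u j ⬝ᵥ u j ≤ ν) (t : Finset ι) :
    ∀ {D : Matrix m m ℝ}, Dᵀ = D →
    ∑ s ∈ t.powerset, p ^ s.card * (1 - p) ^ (t \ s).card *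
      (exp (D + ((p * (1 - Real.exp (-(θ * ν))) / ν) • ∑ j ∈ t, vecMulVec (u j) (u j)
        - θ • ∑ j ∈ s, vecMulVec (u j) (u j)))).trace ≤ (exp D).trace := by
  set c := p * (1 - Real.exp (-(θ * ν))) / ν with hc
  induction t using Finset.induction_on with
  | empty => intro D _; simp
  | insert a t ha ih =>
    intro D hD
    have hVs (b : ℝ) : (D + b • vecMulVec (u a) (u a))ᵀ = D + b • vecMulVec (u a) (u a) := by
      rw [Matrix.transpose_add, Matrix.transpose_smul, vecMulVec_self_transpose, hD]
    refine le_trans (le_of_eq ?_) (trace_exp_step (θ := θ) hD hp0 hp1 hν (u a) (hu a))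
      |>.trans' (add_le_add (mul_le_mul_of_nonneg_left (ih (hVs (c - θ))) hp0)
        (mul_le_mul_of_nonneg_left (ih (hVs c)) (sub_nonneg.2 hp1))) |>.trans' (le_of_eq ?_)
    · rfl
    · rw [Finset.sum_powerset_insert ha, add_comm, Finset.mul_sum, Finset.mul_sum]
      congr 1
      · refine Finset.sum_congr rfl fun s hs => ?_
        have has : a ∉ s := fun h => ha (Finset.mem_powerset.1 hs h)
        rw [Finset.card_insert_of_notMem has, Finset.insert_sdiff_insert,
          Finset.sdiff_insert_of_notMem ha, Finset.sum_insert ha, Finset.sum_insert has, pow_succ]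
        rw [show D + (c • (vecMulVec (u a) (u a) + ∑ j ∈ t, vecMulVec (u j) (u j))
            - θ • (vecMulVec (u a) (u a) + ∑ j ∈ s, vecMulVec (u j) (u j)))
          = D + (c - θ) • vecMulVec (u a) (u a) + (c • ∑ j ∈ t, vecMulVec (u j) (u j)
            - θ • ∑ j ∈ s, vecMulVec (u j) (u j)) by
          simp only [smul_add, sub_smul]; abel]
        ring
      · refine Finset.sum_congr rfl fun s hs => ?_
        have has : a ∉ s := fun h => ha (Finset.mem_powerset.1 hs h)
        rw [Finset.insert_sdiff_of_notMem _ has,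
          Finset.card_insert_of_notMem (fun h => ha (Finset.mem_sdiff.1 h).1),
          Finset.sum_insert ha, pow_succ]
        rw [show D + (c • (vecMulVec (u a) (u a) + ∑ j ∈ t, vecMulVec (u j) (u j))
            - θ • ∑ j ∈ s, vecMulVec (u j) (u j))
          = D + c • vecMulVec (u a) (u a) + (c • ∑ j ∈ t, vecMulVec (u j) (u j)
            - θ • ∑ j ∈ s, vecMulVec (u j) (u j)) by
          simp only [smul_add]; abel]
        ring

variable [Fintype ι]

open Classical in
/-- The **matrix Chernoff bound** for the lower tail of a sampled Gram matrix: total weight of the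
samples for which the Gram matrix drops below `τ` somewhere. -/
theorem sum_weight_gram_lt_le {p θ ν τ : ℝ} (hp0 : 0 ≤ p) (hp1 : p ≤ 1) (hθ : 0 ≤ θ)
    (hν : 0 < ν) (U : Matrix ι m ℝ) (hU : Uᵀ * U = 1) (hu : ∀ j, U j ⬝ᵥ U j ≤ ν) :
    ∑ s : Finset ι with (¬ ∀ y : m → ℝ, τ * (y ⬝ᵥ y) ≤ ∑ j ∈ s, (U *ᵥ y) j ^ 2),
      p ^ s.card * (1 - p) ^ (Finset.univ \ s).card
      ≤ Fintype.card m * Real.exp (θ * τ - p * (1 - Real.exp (-(θ * ν))) / ν) := by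
  set c := p * (1 - Real.exp (-(θ * ν))) / ν with hc
  have h0 := sum_powerset_trace_exp_le (θ := θ) hp0 hp1 hν U hu Finset.univ (D := 0) (by simp)
  rw [Finset.powerset_univ, ← hc] at h0
  have hsum : ∑ j, vecMulVec (U j) (U j) = (1 : Matrix m m ℝ) := by
    rw [← hU]; ext a b
    simp [Matrix.sum_apply, vecMulVec_apply, Matrix.mul_apply]
  simp only [hsum, zero_add, exp_zero, Matrix.trace_one] at h0
  have hw (s : Finset ι) : 0 ≤ p ^ s.card * (1 - p) ^ (Finset.univ \ s).card :=
    mul_nonneg (pow_nonneg hp0 _) (pow_nonneg (sub_nonneg.2 hp1) _)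
  have hsym (s : Finset ι) : (c • (1 : Matrix m m ℝ) - θ • ∑ j ∈ s, vecMulVec (U j) (U j))ᵀ
      = c • (1 : Matrix m m ℝ) - θ • ∑ j ∈ s, vecMulVec (U j) (U j) := by
    simp only [Matrix.transpose_sub, Matrix.transpose_smul, Matrix.transpose_one,
      Matrix.transpose_sum, vecMulVec_self_transpose]
  have hquad (s : Finset ι) (y : m → ℝ) :
      y ⬝ᵥ (c • (1 : Matrix m m ℝ) - θ • ∑ j ∈ s, vecMulVec (U j) (U j)) *ᵥ y
        = c * (y ⬝ᵥ y) - θ * ∑ j ∈ s, (U *ᵥ y) j ^ 2 := by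
    rw [Matrix.sub_mulVec, Matrix.smul_mulVec, Matrix.smul_mulVec, Matrix.one_mulVec,
      dotProduct_sub, dotProduct_smul, dotProduct_smul, Matrix.sum_mulVec, dotProduct_sum]
    simp only [smul_eq_mul]
    congr 2
    refine Finset.sum_congr rfl fun j _ => ?_
    rw [Matrix.vecMulVec_mulVec, op_smul_eq_smul, dotProduct_smul, smul_eq_mul, sq,
      dotProduct_comm y]
    rfl
  -- Markov's inequality: a bad sample has trace at least `e^{c - θτ}`, while the expected trace is
  -- at most the dimension.
  have htr (s : Finset ι) (hs : ¬ ∀ y : m → ℝ, τ * (y ⬝ᵥ y) ≤ ∑ j ∈ s, (U *ᵥ y) j ^ 2) :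
      Real.exp (c - θ * τ)
        ≤ (exp (c • (1 : Matrix m m ℝ) - θ • ∑ j ∈ s, vecMulVec (U j) (U j))).trace := by
    push Not at hs
    obtain ⟨y, hy⟩ := hs
    refine exp_le_trace_exp (hsym s) (y := y) ?_ ?_
    · rintro rfl
      simp at hy
    · rw [hquad]
      have := mul_le_mul_of_nonneg_left hy.le hθ
      linarith
  have hnn (s : Finset ι) :
      0 ≤ (exp (c • (1 : Matrix m m ℝ) - θ • ∑ j ∈ s, vecMulVec (U j) (U j))).trace := by
    set M := c • (1 : Matrix m m ℝ) - θ • ∑ j ∈ s, vecMulVec (U j) (U j)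
    have := Finset.sum_nonneg fun (i : m) (_ : i ∈ Finset.univ) =>
      trace_exp_mul_vecMulVec_nonneg (hsym s) (Pi.single i 1)
    simp only [Matrix.mul_vecMulVec, trace_vecMulVec, dotProduct_single_one,
      Matrix.mulVec_single_one, Matrix.col_apply] at this
    exact this
  rw [show θ * τ - c = -(c - θ * τ) by ring, Real.exp_neg, ← div_eq_mul_inv,
    le_div_iff₀ (Real.exp_pos _), Finset.sum_mul]
  refine le_trans ?_ h0
  refine (Finset.sum_le_sum fun s hs => mul_le_mul_of_nonneg_left
    (htr s (Finset.mem_filter.1 hs).2) (hw s)).trans ?_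
  exact Finset.sum_le_sum_of_subset_of_nonneg (Finset.filter_subset _ _)
    fun s _ _ => mul_nonneg (hw s) (hnn s)

end MatrixChernoff

/-! ### From independent events to weights on finite sets. -/

section Sampling

open MeasureTheory ProbabilityTheory

variable {Ω : Type*} [MeasurableSpace Ω] {P : Measure Ω}
  {ι : Type*} [Fintype ι] {obs : ι → Set Ω} {p : ℝ}

open Classical in
theorem measureReal_setOf_sample_eq [IsProbabilityMeasure P] (hobs : ∀ i, MeasurableSet (obs i))
    (hindep : iIndepSet obs P) (hp0 : 0 ≤ p) (hprob : ∀ i, P (obs i) = ENNReal.ofReal p)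
    (s : Finset ι) :
    P.real {ω | ({j | ω ∈ obs j} : Finset ι) = s}
      = p ^ s.card * (1 - p) ^ (Finset.univ \ s).card := by
  have hset : {ω | ({j | ω ∈ obs j} : Finset ι) = s}
      = ⋂ j ∈ Finset.univ, (if j ∈ s then obs j else (obs j)ᶜ) := by
    ext ω
    simp only [Set.mem_ofPred_eq, Finset.ext_iff, Finset.mem_filter, Finset.mem_univ, true_and,
      Set.iInter_true, Set.mem_iInter]
    refine forall_congr' fun j => ?_
    split_ifs with h <;> simp [h]
  have hreal (j : ι) : P.real (obs j) = p := by
    rw [measureReal_def, hprob, ENNReal.toReal_ofReal hp0]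
  rw [hset, measureReal_def, (iIndepSet_iff obs P).1 hindep Finset.univ, ENNReal.toReal_prod]
  · rw [← Finset.prod_sdiff (Finset.subset_univ s), mul_comm]
    congr 1
    · rw [Finset.prod_congr rfl fun j hj => ?_, Finset.prod_const]
      rw [if_pos hj]; exact hreal j
    · rw [Finset.prod_congr rfl fun j hj => ?_, Finset.prod_const]
      rw [if_neg (Finset.mem_sdiff.1 hj).2]
      exact (probReal_compl_eq_one_sub (hobs j)).trans (by rw [hreal])
  · intro j _
    have : MeasurableSet[MeasurableSpace.generateFrom {obs j}] (obs j) :=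
      MeasurableSpace.measurableSet_generateFrom rfl
    split_ifs
    · exact this
    · exact MeasurableSet.compl this

open Classical in
theorem measureReal_setOf_sample_le [IsProbabilityMeasure P] (hobs : ∀ i, MeasurableSet (obs i))
    (hindep : iIndepSet obs P) (hp0 : 0 ≤ p) (hprob : ∀ i, P (obs i) = ENNReal.ofReal p)
    (Q : Finset ι → Prop) :
    P.real {ω | Q ({j | ω ∈ obs j} : Finset ι)}
      ≤ ∑ s : Finset ι with Q s, p ^ s.card * (1 - p) ^ (Finset.univ \ s).card := by
  have hset : {ω | Q ({j | ω ∈ obs j} : Finset ι)}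
      = ⋃ s ∈ ({s | Q s} : Finset (Finset ι)), {ω | ({j | ω ∈ obs j} : Finset ι) = s} := by
    ext ω; simp
  rw [hset]
  refine (measureReal_biUnion_finset_le _ _).trans (Finset.sum_le_sum fun s _ => ?_)
  exact (measureReal_setOf_sample_eq hobs hindep hp0 hprob s).le

end Sampling

/-! ### Extreme singular values and canonical angles. -/

section SingularValueBounds

open Module

variable {E F : Type*} [NormedAddCommGroup E] [InnerProductSpace ℝ E] [FiniteDimensional ℝ E]
  [NormedAddCommGroup F] [InnerProductSpace ℝ F] [FiniteDimensional ℝ F] (T : E →ₗ[ℝ] F)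

theorem sq_singularValue_mul_sq_norm_le {i : ℕ} (hi : finrank ℝ E ≤ i + 1) (x : E) :
    T.singularValues i ^ 2 * ‖x‖ ^ 2 ≤ ‖T x‖ ^ 2 := by
  have hT := T.isSymmetric_adjoint_comp_self
  set b := hT.eigenvectorBasis rfl with hb
  have h1 : ‖T x‖ ^ 2 = ∑ k, hT.eigenvalues rfl k * ‖inner ℝ (b k) x‖ ^ 2 := by
    have : ‖T x‖ ^ 2 = inner ℝ ((LinearMap.adjoint T ∘ₗ T) x) x := by
      rw [LinearMap.comp_apply, LinearMap.adjoint_inner_left, real_inner_self_eq_norm_sq]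
    rw [this, ← b.sum_inner_mul_inner]
    refine Finset.sum_congr rfl fun k _ => ?_
    rw [hT, hb, hT.apply_eigenvectorBasis, inner_smul_right, real_inner_comm, Real.norm_eq_abs,
      sq_abs, sq, mul_assoc]
    rfl
  rw [h1, ← b.sum_sq_norm_inner_right, Finset.mul_sum]
  refine Finset.sum_le_sum fun k _ => mul_le_mul_of_nonneg_right ?_ (sq_nonneg _)
  rw [← T.sq_singularValues_fin rfl k]
  have : (k : ℕ) ≤ i := by omega
  exact pow_le_pow_left₀ (T.singularValues_nonneg _) (T.singularValues_antitone this) 2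

/-- If the value is nonzero, the normalized images of the first `dim F` right singular vectors form
an orthonormal basis of `F`. Expanding `x` in it and applying Bessel's inequality in `E` gives the
bound. -/
theorem sq_singularValue_mul_sq_norm_le_adjoint {i : ℕ} (hi : finrank ℝ F = i + 1)
    (hEF : finrank ℝ F ≤ finrank ℝ E) (x : F) :
    T.singularValues i ^ 2 * ‖x‖ ^ 2 ≤ ‖LinearMap.adjoint T x‖ ^ 2 := by
  rcases (T.singularValues_nonneg i).eq_or_lt with h0 | hpos
  · rw [← h0]; simp
  have hT := T.isSymmetric_adjoint_comp_self
  set b := hT.eigenvectorBasis rfl with hb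
  let c : Fin (finrank ℝ F) → E := fun k => b (Fin.castLE hEF k)
  have hσ (k : Fin (finrank ℝ F)) : T.singularValues i ≤ T.singularValues k :=
    T.singularValues_antitone (by omega)
  have hσ0 (k : Fin (finrank ℝ F)) : T.singularValues k ≠ 0 := (hpos.trans_le (hσ k)).ne'
  have hinner (k l : Fin (finrank ℝ F)) :
      inner ℝ (T (c k)) (T (c l)) = if k = l then T.singularValues k ^ 2 else 0 := by
    rw [← LinearMap.adjoint_inner_right, ← LinearMap.comp_apply, hT.apply_eigenvectorBasis,
      inner_smul_right, orthonormal_iff_ite.1 b.orthonormal]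
    split_ifs with h1 h2 h2
    · rw [h2, mul_one]
      exact (T.sq_singularValues_fin rfl (Fin.castLE hEF l)).symm
    · exact absurd (Fin.castLE_injective hEF h1) h2
    · exact absurd (congrArg _ h2) h1
    · simp
  have hon : Orthonormal ℝ fun k : Fin (finrank ℝ F) => (T.singularValues k)⁻¹ • T (c k) := by
    rw [orthonormal_iff_ite]
    intro k l
    rw [inner_smul_left, inner_smul_right, hinner]
    split_ifs with h
    · subst h
      have := hσ0 k
      simp only [RCLike.conj_to_real]
      field_simp
    · simp
  let f := OrthonormalBasis.mk hon
    (hon.linearIndependent.span_eq_top_of_card_eq_finrank' (Fintype.card_fin _)).ge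
  have hf (k) : f k = (T.singularValues k)⁻¹ • T (c k) := by
    simp [f]
  calc T.singularValues i ^ 2 * ‖x‖ ^ 2
      = ∑ k, T.singularValues i ^ 2 * ‖inner ℝ (f k) x‖ ^ 2 := by
        rw [← Finset.mul_sum, f.sum_sq_norm_inner_right]
    _ ≤ ∑ k, ‖inner ℝ (c k) (LinearMap.adjoint T x)‖ ^ 2 := by
        refine Finset.sum_le_sum fun k _ => ?_
        rw [LinearMap.adjoint_inner_right, hf, inner_smul_left, norm_mul, mul_pow, ← mul_assoc]
        refine mul_le_of_le_one_left (sq_nonneg _) ?_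
        simp only [RCLike.conj_to_real, norm_inv, Real.norm_eq_abs, inv_pow, sq_abs]
        rw [← div_eq_mul_inv, div_le_one (by have := hσ0 k; positivity)]
        exact pow_le_pow_left₀ hpos.le (hσ k) 2
    _ ≤ ‖LinearMap.adjoint T x‖ ^ 2 := by
        have := (b.orthonormal.comp _ (Fin.castLE_injective hEF)).sum_inner_products_le
          (LinearMap.adjoint T x) (s := Finset.univ)
        exact this

/-- The last singular value `σ` of the cross map is the smallest cosine, so the projection keeps at
least `σ² |y|²`; by Pythagoras at most `(1 - σ²) |y|²` is lost. -/
theorem sq_norm_sub_orthogonalProjection_le (X Y : Submodule ℝ E)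
    (hXY : finrank ℝ Y ≤ finrank ℝ X) {s : ℝ}
    (hs : ∀ j, Real.sin (canonicalAngle X Y j) ≤ s) (y : Y) :
    ‖(y : E) - X.orthogonalProjectionOnto (y : E)‖ ^ 2 ≤ s ^ 2 * ‖(y : E)‖ ^ 2 := by
  rcases Nat.eq_zero_or_pos (finrank ℝ X) with h0 | hpos
  · have hY : Y = ⊥ := Submodule.finrank_eq_zero.1 (by omega)
    have : (y : E) = 0 := (Submodule.mem_bot ℝ).1 (hY.le y.2)
    simp [this]
  have h1 := sq_singularValue_mul_sq_norm_le (crossMap X Y) (i := finrank ℝ X - 1)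
    (by omega) y
  have h2 := hs ⟨finrank ℝ X - 1, by omega⟩
  rw [canonicalAngle, Real.sin_arccos] at h2
  simp only at h2
  set σ := (crossMap X Y).singularValues (finrank ℝ X - 1)
  have h3 : 1 - σ ^ 2 ≤ s ^ 2 := (Real.sqrt_le_left ((Real.sqrt_nonneg _).trans h2)).1 h2
  have h4 : ‖(y : E)‖ ^ 2 = ‖X.orthogonalProjectionOnto (y : E)‖ ^ 2
      + ‖(y : E) - X.orthogonalProjectionOnto (y : E)‖ ^ 2 := by
    have horth : inner ℝ ((y : E) - X.orthogonalProjectionOnto (y : E))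
        (X.orthogonalProjectionOnto (y : E) : E) = 0 := by
      exact X.starProjection_inner_eq_zero _ _ (X.orthogonalProjectionOnto (y : E)).2
    have := norm_add_sq_eq_norm_sq_add_norm_sq_of_inner_eq_zero _ _ horth
    rw [sub_add_cancel] at this
    simp only [Submodule.coe_norm, sq]
    linarith
  have h5 : ‖crossMap X Y y‖ = ‖X.orthogonalProjectionOnto (y : E)‖ := rfl
  have h6 : ‖y‖ = ‖(y : E)‖ := rfl
  rw [h5, h6] at h1
  have := mul_le_mul_of_nonneg_right h3 (sq_nonneg ‖(y : E)‖)
  linarith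

end SingularValueBounds

/-! ### Matrix forms of these bounds. -/

section MatrixBounds

open Matrix Module

variable {m n n' : Type*} [Fintype m] [Fintype n] [DecidableEq n] [Fintype n'] [DecidableEq n']

theorem sq_norm_toLp (v : m → ℝ) : ‖(WithLp.toLp 2 v : EuclideanSpace ℝ m)‖ ^ 2 = v ⬝ᵥ v := by
  rw [EuclideanSpace.real_norm_sq_eq]
  exact Finset.sum_congr rfl fun i _ => sq _

theorem sq_sigmaMin_mul_le [DecidableEq m] [Nonempty m] (A : Matrix m n ℝ)
    (h : Fintype.card m ≤ Fintype.card n) (x : m → ℝ) :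
    sigmaMin A ^ 2 * (x ⬝ᵥ x) ≤ (Aᵀ *ᵥ x) ⬝ᵥ (Aᵀ *ᵥ x) := by
  have hm : 0 < Fintype.card m := Fintype.card_pos
  have := sq_singularValue_mul_sq_norm_le_adjoint (toEuclideanLin A)
    (i := Fintype.card m - 1) (by rw [finrank_euclideanSpace]; omega)
    (by simpa only [finrank_euclideanSpace] using h) (WithLp.toLp 2 x)
  rw [← toEuclideanLin_conjTranspose_eq_adjoint, toLpLin_apply, sq_norm_toLp, sq_norm_toLp,
    conjTranspose_eq_transpose_of_trivial] at this
  rwa [sigmaMin, min_eq_left h]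

/-- Natural subtraction makes the index `0 - 1 = 0`, and the zero map has zero singular values. This
is how `gmin > 0` excludes `r k = 0`. -/
theorem sigmaMin_eq_zero_of_isEmpty [IsEmpty m] (A : Matrix m n ℝ) : sigmaMin A = 0 := by
  rw [sigmaMin, Subsingleton.elim (toEuclideanLin A) 0, LinearMap.singularValues_zero]
  rfl

theorem finrank_colSpace (A : Matrix m n ℝ) : finrank ℝ (colSpace A) ≤ Fintype.card n := by
  have := LinearMap.finrank_range_le (toEuclideanLin A)
  rwa [finrank_euclideanSpace] at this

theorem finrank_colSpace_of_injective (A : Matrix m n ℝ)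
    (hA : ∀ x, A *ᵥ x = 0 → x = 0) : finrank ℝ (colSpace A) = Fintype.card n := by
  rw [colSpace, LinearMap.finrank_range_of_inj, finrank_euclideanSpace]
  rw [← LinearMap.ker_eq_bot, LinearMap.ker_eq_bot']
  intro x hx
  have : A *ᵥ x.ofLp = 0 := congrArg WithLp.ofLp hx
  exact congrArg (WithLp.toLp 2) (hA _ this)

theorem sinThetaNorm_nonneg (A : Matrix m n ℝ) (B : Matrix m n' ℝ) : 0 ≤ sinThetaNorm A B :=
  norm_nonneg _

/-- Every vector of the column space of `B` is approximated by the column space of `A` up to the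
sine of the largest canonical angle. -/
theorem exists_mulVec_sub_le (A : Matrix m n ℝ) (B : Matrix m n' ℝ)
    (h : finrank ℝ (colSpace B) ≤ finrank ℝ (colSpace A)) (w : n' → ℝ) :
    ∃ z, (A *ᵥ z - B *ᵥ w) ⬝ᵥ (A *ᵥ z - B *ᵥ w)
      ≤ sinThetaNorm A B ^ 2 * ((B *ᵥ w) ⬝ᵥ (B *ᵥ w)) := by
  have hs (j) : Real.sin (canonicalAngle (colSpace A) (colSpace B) j) ≤ sinThetaNorm A B := by
    rw [sinThetaNorm, l2_opNorm_diagonal]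
    exact (le_abs_self _).trans
      (norm_le_pi_norm (fun j => Real.sin (canonicalAngle (colSpace A) (colSpace B) j)) j)
  let y : colSpace B := ⟨WithLp.toLp 2 (B *ᵥ w), ⟨WithLp.toLp 2 w, rfl⟩⟩
  have key := sq_norm_sub_orthogonalProjection_le _ _ h hs y
  obtain ⟨z, hz⟩ := ((colSpace A).orthogonalProjectionOnto (y : EuclideanSpace ℝ m)).2
  refine ⟨z.ofLp, ?_⟩
  rw [← hz, norm_sub_rev] at key
  rw [← sq_norm_toLp, ← sq_norm_toLp]
  exact key

/-- The spectral norm is at most the Frobenius norm. -/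
theorem sq_norm_le_sum_sq (A : Matrix m n ℝ) : ‖A‖ ^ 2 ≤ ∑ i, ∑ j, A i j ^ 2 := by
  rw [← Real.le_sqrt (norm_nonneg _) (by positivity), l2_opNorm_def]
  refine ContinuousLinearMap.opNorm_le_bound _ (Real.sqrt_nonneg _) fun x => ?_
  rw [← Real.sqrt_sq (norm_nonneg x), ← Real.sqrt_mul (by positivity)]
  apply Real.le_sqrt_of_sq_le
  rw [EuclideanSpace.real_norm_sq_eq, EuclideanSpace.real_norm_sq_eq, Finset.sum_mul]
  exact Finset.sum_le_sum fun i _ => Finset.sum_mul_sq_le_sq_mul_sq _ _ _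

theorem mulVec_dotProduct_self_le (A : Matrix m n ℝ) (x : n → ℝ) :
    (A *ᵥ x) ⬝ᵥ (A *ᵥ x) ≤ ‖A‖ ^ 2 * (x ⬝ᵥ x) := by
  have := l2_opNorm_mulVec A (WithLp.toLp 2 x)
  rw [← sq_norm_toLp, ← sq_norm_toLp, ← mul_pow]
  exact pow_le_pow_left₀ (norm_nonneg _) this 2

theorem mulVec_dotProduct_self_of_orthonormal {A : Matrix m n ℝ} (hA : Aᵀ * A = 1) (x : n → ℝ) :
    (A *ᵥ x) ⬝ᵥ (A *ᵥ x) = x ⬝ᵥ x := by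
  rw [Matrix.dotProduct_mulVec, ← Matrix.mulVec_transpose, Matrix.mulVec_mulVec, hA,
    Matrix.one_mulVec]

/-- A matrix factors through an orthonormal basis of its column space. -/
theorem exists_orthonormal_factor (A : Matrix m n ℝ) :
    ∃ (k : ℕ) (Q : Matrix m (Fin k) ℝ) (R : Matrix (Fin k) n ℝ),
      k ≤ Fintype.card n ∧ Qᵀ * Q = 1 ∧ A = Q * R := by
  let b := stdOrthonormalBasis ℝ (colSpace A)
  refine ⟨finrank ℝ (colSpace A), Matrix.of fun i a => (b a : EuclideanSpace ℝ m) i,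
    Matrix.of fun a j => b.repr ⟨WithLp.toLp 2 (A *ᵥ Pi.single j 1),
      ⟨WithLp.toLp 2 (Pi.single j 1), rfl⟩⟩ a, finrank_colSpace A, ?_, ?_⟩
  · ext a a'
    have := orthonormal_iff_ite.1 b.orthonormal a a'
    rw [Submodule.coe_inner, EuclideanSpace.inner_eq_star_dotProduct] at this
    rw [Matrix.mul_apply, Matrix.one_apply, ← this]
    exact Finset.sum_congr rfl fun i _ => mul_comm _ _
  · ext i j
    have := b.sum_repr ⟨WithLp.toLp 2 (A *ᵥ Pi.single j 1), ⟨WithLp.toLp 2 (Pi.single j 1), rfl⟩⟩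
    have h2 := congrArg (fun v : colSpace A => (v : EuclideanSpace ℝ m) i) this
    simp only [Submodule.coe_sum, Submodule.coe_smul, WithLp.ofLp_sum, Finset.sum_apply,
      WithLp.ofLp_smul, Pi.smul_apply, smul_eq_mul, Matrix.mulVec_single_one, Matrix.col_apply]
      at h2
    rw [Matrix.mul_apply, ← h2]
    refine Finset.sum_congr rfl fun a _ => ?_
    rw [mul_comm]
    simp only [Matrix.of_apply, Matrix.mulVec_single_one]

theorem dotProduct_self_mulVec_le_of_orthonormal {A : Matrix m n ℝ} (hA : Aᵀ * A = 1)
    (x : m → ℝ) : (Aᵀ *ᵥ x) ⬝ᵥ (Aᵀ *ᵥ x) ≤ x ⬝ᵥ x := by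
  have h : 0 ≤ (x - A *ᵥ (Aᵀ *ᵥ x)) ⬝ᵥ (x - A *ᵥ (Aᵀ *ᵥ x)) :=
    Finset.sum_nonneg fun i _ => mul_self_nonneg _
  have h1 : x ⬝ᵥ A *ᵥ (Aᵀ *ᵥ x) = (Aᵀ *ᵥ x) ⬝ᵥ (Aᵀ *ᵥ x) := by
    rw [Matrix.dotProduct_mulVec, ← Matrix.mulVec_transpose]
  rw [sub_dotProduct, dotProduct_sub, dotProduct_sub,
    mulVec_dotProduct_self_of_orthonormal hA, dotProduct_comm (A *ᵥ Aᵀ *ᵥ x) x, h1] at h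
  linarith

end MatrixBounds

/-! ### Unfoldings and Kronecker products. -/

section Unfolding

open Matrix

variable {N : ℕ} {d r : Fin N → ℕ}

theorem sum_eq_sum_unfold (n : Fin N) (f : (∀ k, Fin (d k)) → ℝ) :
    ∑ i, f i = ∑ a, ∑ j : CoIndex d n,
      f ((Equiv.piSplitAt n fun k => Fin (d k)).symm (a, j)) := by
  rw [← (Equiv.piSplitAt n fun k => Fin (d k)).symm.sum_comp, Fintype.sum_prod_type]

theorem piSplitAt_symm_self (n : Fin N) (a : Fin (d n)) (j : CoIndex d n) :
    (Equiv.piSplitAt n fun k => Fin (d k)).symm (a, j) n = a := by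
  simp [Equiv.piSplitAt]

theorem piSplitAt_symm_ne (n : Fin N) (a : Fin (d n)) (j : CoIndex d n) (k : {k // k ≠ n}) :
    (Equiv.piSplitAt n fun k => Fin (d k)).symm (a, j) k = j k := by
  simp [Equiv.piSplitAt, k.2]

theorem unfold_multiProd (n : Fin N) (G : Tensor r) (B : ∀ k, Matrix (Fin (d k)) (Fin (r k)) ℝ) :
    unfold n (multiProd G B) = B n * (kronExcept n B * (unfold n G)ᵀ)ᵀ := by
  ext a j
  simp only [unfold, multiProd, Matrix.of_apply, Matrix.mul_apply, Matrix.transpose_apply,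
    kronExcept]
  rw [sum_eq_sum_unfold n]
  refine Finset.sum_congr rfl fun b _ => ?_
  rw [Finset.mul_sum]
  refine Finset.sum_congr rfl fun s _ => ?_
  rw [Fintype.prod_eq_mul_prod_subtype_ne _ n]
  simp only [piSplitAt_symm_self, piSplitAt_symm_ne]
  ring

theorem kronExcept_update (n : Fin N) (B : ∀ k, Matrix (Fin (d k)) (Fin (r k)) ℝ)
    (X : Matrix (Fin (d n)) (Fin (r n)) ℝ) :
    kronExcept n (Function.update B n X) = kronExcept n B := by
  ext j s
  simp only [kronExcept, Matrix.of_apply]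
  refine Finset.prod_congr rfl fun k _ => ?_
  rw [Function.update_of_ne k.2]

theorem unfold_lsTensor (n : Fin N) (G : Tensor r)
    (Aold Anew : ∀ k, Matrix (Fin (d k)) (Fin (r k)) ℝ) (X : Matrix (Fin (d n)) (Fin (r n)) ℝ) :
    unfold n (lsTensor n G Aold Anew X)
      = X * (kronExcept n (mixed n Aold Anew) * (unfold n G)ᵀ)ᵀ := by
  rw [lsTensor, unfold_multiProd, Function.update_self, kronExcept_update]

theorem kronExcept_orthonormal (n : Fin N) {B : ∀ k, Matrix (Fin (d k)) (Fin (r k)) ℝ}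
    (hB : ∀ k, k ≠ n → (B k)ᵀ * B k = 1) : (kronExcept n B)ᵀ * kronExcept n B = 1 := by
  ext s s'
  simp only [Matrix.mul_apply, Matrix.transpose_apply, kronExcept, Matrix.of_apply,
    ← Finset.prod_mul_distrib]
  rw [← Fintype.prod_sum fun (k : {k // k ≠ n}) i => B k.1 i (s k) * B k.1 i (s' k)]
  have (k : {k // k ≠ n}) : ∑ i, B k.1 i (s k) * B k.1 i (s' k) = if s k = s' k then 1 else 0 := by
    rw [← Matrix.one_apply, ← hB k.1 k.2]
    simp [Matrix.mul_apply]
  simp only [this, Matrix.one_apply]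
  rw [Finset.prod_ite_zero]
  simp [funext_iff]

theorem kronExcept_row (n : Fin N) (B : ∀ k, Matrix (Fin (d k)) (Fin (r k)) ℝ) {x : Fin N → ℝ}
    (hB : ∀ k, k ≠ n → ∀ i, ∑ s, B k i s ^ 2 ≤ x k) (j : CoIndex d n) :
    kronExcept n B j ⬝ᵥ kronExcept n B j ≤ ∏ k : {k // k ≠ n}, x k := by
  simp only [dotProduct, kronExcept, Matrix.of_apply, ← Finset.prod_mul_distrib]
  rw [← Fintype.prod_sum fun (k : {k // k ≠ n}) s => B k.1 (j k) s * B k.1 (j k) s]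
  refine Finset.prod_le_prod (fun k _ => Finset.sum_nonneg fun s _ => mul_self_nonneg _)
    fun k _ => ?_
  simpa only [sq] using hB k.1 k.2 (j k)

theorem frobNorm_sq (T : Tensor d) (n : Fin N) :
    frobNorm T ^ 2 = ∑ a, ∑ j, unfold n T a j ^ 2 := by
  rw [frobNorm, Real.sq_sqrt (Finset.sum_nonneg fun _ _ => sq_nonneg _), sum_eq_sum_unfold n]
  rfl

open Classical in
theorem frobNorm_proj_sub_sq (S : Set (∀ k, Fin (d k))) (T T' : Tensor d) (n : Fin N) :
    frobNorm (proj S T - proj S T') ^ 2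
      = ∑ a, ∑ j : CoIndex d n with (Equiv.piSplitAt n fun k => Fin (d k)).symm (a, j) ∈ S,
        (unfold n T a j - unfold n T' a j) ^ 2 := by
  rw [frobNorm_sq _ n]
  refine Finset.sum_congr rfl fun a _ => ?_
  rw [Finset.sum_filter]
  refine Finset.sum_congr rfl fun j _ => ?_
  simp only [unfold, Matrix.of_apply, Pi.sub_apply, proj]
  split_ifs <;> simp

end Unfolding

/-! ### Full and sampled least squares. -/

section LeastSquares

open Matrix

/-- A minimum at `t = 1` forces `B = -H`, so the minimal value, which is nonnegative, is `A - H`. -/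
theorem le_of_forall_quadratic {A B H : ℝ} (hA : 0 ≤ A) (hH : 0 ≤ H)
    (hmin : ∀ t : ℝ, A + 2 * 1 * B + 1 ^ 2 * H ≤ A + 2 * t * B + t ^ 2 * H)
    (hnn : 0 ≤ A + 2 * 1 * B + 1 ^ 2 * H) : H ≤ A := by
  rcases hH.eq_or_lt with h0 | hpos
  · rw [← h0]; exact hA
  -- The test point is the vertex `-B/H`.
  have h1 := hmin (1 - (B + H) / H)
  have h2 : A + 2 * (1 - (B + H) / H) * B + (1 - (B + H) / H) ^ 2 * H
      = A + 2 * 1 * B + 1 ^ 2 * H - (B + H) ^ 2 / H := by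
    field_simp; ring
  have h3 : (B + H) ^ 2 / H ≤ 0 := by linarith
  have h4 : (B + H) ^ 2 = 0 :=
    le_antisymm (by rw [div_le_iff₀ hpos] at h3; linarith) (sq_nonneg _)
  have h5 : B = -H := by have := pow_eq_zero_iff (two_ne_zero) |>.1 h4; linarith
  rw [h5] at hnn
  linarith

variable {I J κ : Type*} [Fintype I] [Fintype J] [Fintype κ]

/-- If the sampled Gram matrices are bounded below, then a sampled least-squares solution is as
close to any other point as the full residual of that point allows. -/
theorem sampled_leastSquares_le (W : Matrix J κ ℝ) (T : Matrix I J ℝ) (S : I → Finset J)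
    {X₀ X₁ : Matrix I κ ℝ} {τ : ℝ}
    (hmin : ∀ X : Matrix I κ ℝ, ∑ i, ∑ j ∈ S i, ((X₁ * Wᵀ) i j - T i j) ^ 2
      ≤ ∑ i, ∑ j ∈ S i, ((X * Wᵀ) i j - T i j) ^ 2)
    (hgram : ∀ i, ∀ x : κ → ℝ, τ * ((W *ᵥ x) ⬝ᵥ (W *ᵥ x)) ≤ ∑ j ∈ S i, (W *ᵥ x) j ^ 2) :
    τ * ∑ i, (W *ᵥ (X₁ - X₀) i) ⬝ᵥ (W *ᵥ (X₁ - X₀) i)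
      ≤ ∑ i, ∑ j, ((X₀ * Wᵀ) i j - T i j) ^ 2 := by
  have hrow (X : Matrix I κ ℝ) (i : I) (j : J) : (X * Wᵀ) i j = (W *ᵥ X i) j := by
    simp [Matrix.mul_apply, Matrix.mulVec, dotProduct, mul_comm]
  set a : I → J → ℝ := fun i j => (X₀ * Wᵀ) i j - T i j with ha
  set h : I → J → ℝ := fun i j => (W *ᵥ (X₁ - X₀) i) j with hh
  -- The sampled objective on the line from `X₀` (`t = 0`) to `X₁` (`t = 1`) is a quadratic in `t`,
  -- minimal at `t = 1`.
  have hexp (t : ℝ) : ∑ i, ∑ j ∈ S i, (((X₀ + t • (X₁ - X₀)) * Wᵀ) i j - T i j) ^ 2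
      = ∑ i, ∑ j ∈ S i, a i j ^ 2 + 2 * t * ∑ i, ∑ j ∈ S i, a i j * h i j
        + t ^ 2 * ∑ i, ∑ j ∈ S i, h i j ^ 2 := by
    simp only [Finset.mul_sum, ← Finset.sum_add_distrib]
    refine Finset.sum_congr rfl fun i _ => Finset.sum_congr rfl fun j _ => ?_
    have : ((X₀ + t • (X₁ - X₀)) * Wᵀ) i j = (X₀ * Wᵀ) i j + t * h i j := by
      rw [Matrix.add_mul, Matrix.smul_mul, Matrix.add_apply, Matrix.smul_apply, smul_eq_mul,
        hrow (X₁ - X₀)]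
    rw [this, ha]
    ring
  have h1 : X₀ + (1 : ℝ) • (X₁ - X₀) = X₁ := by simp
  have hH : ∑ i, ∑ j ∈ S i, h i j ^ 2 ≤ ∑ i, ∑ j ∈ S i, a i j ^ 2 := by
    refine le_of_forall_quadratic (B := ∑ i, ∑ j ∈ S i, a i j * h i j) (by positivity)
      (by positivity) (fun t => ?_) ?_
    · rw [← hexp, ← hexp, h1]
      exact hmin _
    · rw [← hexp]
      positivity
  rw [Finset.mul_sum]
  refine (Finset.sum_le_sum fun i _ => hgram i _).trans (hH.trans ?_)
  exact Finset.sum_le_sum fun i _ =>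
    Finset.sum_le_sum_of_subset_of_nonneg (Finset.subset_univ _) fun _ _ _ => sq_nonneg _

variable [DecidableEq κ] [DecidableEq I] [DecidableEq J]

/-- The least-squares residual of a matrix `A * Vᵀ` over the row space of `Wᵀ` is controlled by the
angles between the column spaces of `W` and `V`. -/
theorem leastSquares_residual_le (W V : Matrix J κ ℝ) (A : Matrix I κ ℝ)
    (hA : Aᵀ * A = 1)
    (hrank : Module.finrank ℝ (colSpace V) ≤ Module.finrank ℝ (colSpace W))
    {X₀ : Matrix I κ ℝ}
    (hmin : ∀ X : Matrix I κ ℝ, ∑ i, ∑ j, ((X₀ * Wᵀ) i j - (A * Vᵀ) i j) ^ 2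
      ≤ ∑ i, ∑ j, ((X * Wᵀ) i j - (A * Vᵀ) i j) ^ 2) :
    ∑ i, ∑ j, ((X₀ * Wᵀ) i j - (A * Vᵀ) i j) ^ 2
      ≤ Fintype.card κ * (sinThetaNorm W V ^ 2 * ‖A * Vᵀ‖ ^ 2) := by
  choose Z hZ using fun b : κ => exists_mulVec_sub_le W V hrank (Pi.single b 1)
  have hV (b : κ) : (V *ᵥ Pi.single b 1) ⬝ᵥ (V *ᵥ Pi.single b 1) ≤ ‖A * Vᵀ‖ ^ 2 := by
    -- Columns of `V` are images of unit vectors under the transpose of `A Vᵀ`, so its spectral norm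
    -- bounds their length.
    have h1 : V *ᵥ Pi.single b 1 = (A * Vᵀ)ᵀ *ᵥ (A *ᵥ Pi.single b 1) := by
      rw [Matrix.mulVec_mulVec, Matrix.transpose_mul, Matrix.transpose_transpose,
        Matrix.mul_assoc, hA, Matrix.mul_one]
    rw [h1]
    refine (mulVec_dotProduct_self_le _ _).trans_eq ?_
    rw [mulVec_dotProduct_self_of_orthonormal hA, ← conjTranspose_eq_transpose_of_trivial,
      l2_opNorm_conjTranspose]
    simp
  let D : Matrix κ J ℝ := Matrix.of fun b j => (W *ᵥ Z b - V *ᵥ Pi.single b 1) j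
  have hres (i : I) (j : J) :
      ((A * Matrix.of Z) * Wᵀ) i j - (A * Vᵀ) i j = (A *ᵥ fun b => D b j) i := by
    have : Matrix.of Z * Wᵀ - Vᵀ = D := by
      ext b j
      simp [D, Matrix.mul_apply, Matrix.mulVec, dotProduct, mul_comm]
    rw [← Matrix.sub_apply, Matrix.mul_assoc, ← Matrix.mul_sub, this]
    rfl
  -- The competitor `A Z` has residual `A D`, and the isometry `A` preserves the Frobenius norm of
  -- `D`. Summing over the columns of `V` gives the factor `card κ`.
  calc _ ≤ _ := hmin (A * Matrix.of Z)
    _ = ∑ j, ∑ i, (A *ᵥ fun b => D b j) i ^ 2 := by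
        rw [Finset.sum_comm]; simp only [hres]
    _ = ∑ j, ∑ b, D b j ^ 2 := by
        refine Finset.sum_congr rfl fun j _ => ?_
        have := mulVec_dotProduct_self_of_orthonormal hA fun b => D b j
        simpa only [dotProduct, sq] using this
    _ = ∑ b, (W *ᵥ Z b - V *ᵥ Pi.single b 1) ⬝ᵥ (W *ᵥ Z b - V *ᵥ Pi.single b 1) := by
        rw [Finset.sum_comm]; simp only [dotProduct, sq]; rfl
    _ ≤ ∑ _b : κ, sinThetaNorm W V ^ 2 * ‖A * Vᵀ‖ ^ 2 :=
        Finset.sum_le_sum fun b _ =>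
          (hZ b).trans (mul_le_mul_of_nonneg_left (hV b) (sq_nonneg _))
    _ = _ := by simp

end LeastSquares

/-! ### The Chernoff bound for one row. -/

section GramSampling

open Matrix MeasureTheory ProbabilityTheory

variable {Ω : Type*} [MeasurableSpace Ω] {P : Measure Ω} [IsProbabilityMeasure P]
  {J R κ : Type*} [Fintype J] [Fintype R] [DecidableEq R] [Fintype κ]
  [DecidableEq κ] {obs : J → Set Ω} {p : ℝ}

-- The columns of `M * H` need not be orthonormal, so the Chernoff bound is applied to `U = M * Q`,
-- with `Q` an orthonormal basis of the column space of `H`. Every `(M * H) x` has the form `U y`,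
-- and rows of `U` are no longer than those of `M`.
open Classical in
theorem measureReal_gram_lt_le (hobs : ∀ i, MeasurableSet (obs i))
    (hindep : iIndepSet obs P) (hp0 : 0 ≤ p) (hp1 : p ≤ 1)
    (hprob : ∀ i, P (obs i) = ENNReal.ofReal p)
    {M : Matrix J R ℝ} (hM : Mᵀ * M = 1) {ν : ℝ} (hν : 0 < ν) (hrow : ∀ j, M j ⬝ᵥ M j ≤ ν)
    (H : Matrix R κ ℝ) {θ : ℝ} (hθ : 0 ≤ θ) (τ : ℝ) :
    P.real {ω | ¬ ∀ x : κ → ℝ, τ * (((M * H) *ᵥ x) ⬝ᵥ ((M * H) *ᵥ x))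
        ≤ ∑ j with ω ∈ obs j, ((M * H) *ᵥ x) j ^ 2}
      ≤ Fintype.card κ * Real.exp (θ * τ - p * (1 - Real.exp (-(θ * ν))) / ν) := by
  obtain ⟨k, Q, K, hk, hQ, hHK⟩ := exists_orthonormal_factor H
  set U := M * Q with hU
  have hUU : Uᵀ * U = 1 := by
    rw [hU, Matrix.transpose_mul, Matrix.mul_assoc, ← Matrix.mul_assoc Mᵀ, hM, Matrix.one_mul, hQ]
  have hUrow (j : J) : U j ⬝ᵥ U j ≤ ν := by
    have : U j = Qᵀ *ᵥ M j := by
      ext a; simp [hU, Matrix.mul_apply, Matrix.mulVec, dotProduct, mul_comm]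
    rw [this]
    exact (dotProduct_self_mulVec_le_of_orthonormal hQ _).trans (hrow j)
  have hsub : {ω | ¬ ∀ x : κ → ℝ, τ * (((M * H) *ᵥ x) ⬝ᵥ ((M * H) *ᵥ x))
        ≤ ∑ j with ω ∈ obs j, ((M * H) *ᵥ x) j ^ 2}
      ⊆ {ω | ¬ ∀ y : Fin k → ℝ, τ * (y ⬝ᵥ y) ≤ ∑ j with ω ∈ obs j, (U *ᵥ y) j ^ 2} := by
    intro ω hω hgood
    refine hω fun x => ?_
    have e : (M * H) *ᵥ x = U *ᵥ (K *ᵥ x) := by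
      rw [Matrix.mulVec_mulVec, hU, hHK, Matrix.mul_assoc]
    rw [e, mulVec_dotProduct_self_of_orthonormal hUU]
    exact hgood _
  refine (measureReal_mono hsub).trans ?_
  refine (measureReal_setOf_sample_le hobs hindep hp0 hprob
    (fun s => ¬ ∀ y : Fin k → ℝ, τ * (y ⬝ᵥ y) ≤ ∑ j ∈ s, (U *ᵥ y) j ^ 2)).trans ?_
  refine le_trans (le_of_eq ?_)
    ((sum_weight_gram_lt_le (τ := τ) hp0 hp1 hθ hν U hUU hUrow).trans ?_)
  · congr!
  rw [Fintype.card_fin]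
  gcongr

end GramSampling

/-! ### Consequences of incoherence. -/

section Incoherence

open Matrix

theorem card_le_card_of_orthonormal {d r : ℕ} {A : Matrix (Fin d) (Fin r) ℝ} (hA : Aᵀ * A = 1) :
    r ≤ d := by
  have h1 := Matrix.rank_mul_le_right Aᵀ A
  rw [hA, Matrix.rank_one, Fintype.card_fin] at h1
  exact h1.trans (Matrix.rank_le_height A)

/-- The bound is `√x ^ 2` and not `x`, since `x` is not assumed nonnegative. -/
theorem sum_sq_row_le_of_twoInfNorm_le {d r : ℕ} {A : Matrix (Fin d) (Fin r) ℝ} {x : ℝ}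
    (h : twoInfNorm A ≤ √x) (i : Fin d) : ∑ j, A i j ^ 2 ≤ √x ^ 2 := by
  have h1 : √(∑ j, A i j ^ 2) ≤ √x :=
    (le_ciSup (f := fun i => √(∑ j, A i j ^ 2)) (Set.finite_range _).bddAbove i).trans h
  rw [← Real.sq_sqrt (Finset.sum_nonneg fun j _ => sq_nonneg (A i j))]
  exact pow_le_pow_left₀ (Real.sqrt_nonneg _) h1 2

theorem card_le_of_twoInfNorm_le {d r : ℕ} {A : Matrix (Fin d) (Fin r) ℝ} (hA : Aᵀ * A = 1)
    {x : ℝ} (h : twoInfNorm A ≤ √x) : (r : ℝ) ≤ d * √x ^ 2 := by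
  have h1 : (r : ℝ) = ∑ i, ∑ j, A i j ^ 2 := by
    rw [Finset.sum_comm]
    have (j : Fin r) : ∑ i, A i j ^ 2 = 1 := by
      have := congrFun (congrFun hA j) j
      rw [Matrix.mul_apply, Matrix.one_apply_eq] at this
      rw [← this]
      exact Finset.sum_congr rfl fun i _ => sq _
    simp [this]
  rw [h1]
  refine (Finset.sum_le_sum fun i _ => sum_sq_row_le_of_twoInfNorm_le h i).trans_eq ?_
  simp

/-- The coherence parameter of a nonempty orthonormal family is at least one. -/
theorem one_le_of_twoInfNorm_le {d r : ℕ} {A : Matrix (Fin d) (Fin r) ℝ} (hA : Aᵀ * A = 1)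
    (hr : 0 < r) {μ : ℝ} (h : twoInfNorm A ≤ √(μ * r / d)) : 1 ≤ μ := by
  have h1 := card_le_of_twoInfNorm_le hA h
  have hr' : (0 : ℝ) < r := by exact_mod_cast hr
  have hd : (0 : ℝ) < d := by exact_mod_cast hr.trans_le (card_le_card_of_orthonormal hA)
  rcases le_or_gt (μ * r / d) 0 with h0 | h0
  · rw [Real.sqrt_eq_zero_of_nonpos h0] at h1
    norm_num at h1
    linarith
  · rw [Real.sq_sqrt h0.le, mul_div_cancel₀ _ hd.ne'] at h1
    exact le_of_mul_le_mul_right (by linarith) hr'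

theorem prod_subtype_ne {N : ℕ} (n : Fin N) (f : Fin N → ℝ) :
    ∏ k : {k // k ≠ n}, f k = ∏ k ∈ Finset.univ.erase n, f k :=
  (Finset.prod_subtype _ (by simp) f).symm

theorem card_coIndex {N : ℕ} (r : Fin N → ℕ) (n : Fin N) :
    (Fintype.card (CoIndex r n) : ℝ) = ∏ k ∈ Finset.univ.erase n, (r k : ℝ) := by
  rw [← prod_subtype_ne, Fintype.card_pi]
  simp

/-- If `I_n ≤ J_n`, the term `m = n` suffices. Otherwise any `m ≠ n` does: `I_m ≤ J_n < I_n`, and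
with `D` the product of the sizes other than `I_m` and `I_n`, `r_n ≤ r_m D` while `J_m = I_n D`. -/
theorem sqrt_le_iSup_sqrt {N : ℕ} {d r : Fin N → ℕ} {μ : Fin N → ℝ} {n : Fin N}
    (hμ : ∀ k, 1 ≤ μ k) (hr : ∀ k, 0 < r k) (hrd : ∀ k, r k ≤ d k)
    (hprod : (r n : ℝ) ≤ ∏ k ∈ Finset.univ.erase n, (r k : ℝ))
    (hne : (Finset.univ.erase n).Nonempty) :
    √(r n) ≤ ⨆ m, √(μ m * r m * coSize d m / d m) := by
  have hd (k) : (0 : ℝ) < d k := by exact_mod_cast (hr k).trans_le (hrd k)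
  have hd1 (k) : (1 : ℝ) ≤ d k := by exact_mod_cast (hr k).trans_le (hrd k)
  suffices h : ∃ m, (r n : ℝ) ≤ r m * coSize d m / d m by
    obtain ⟨m, hm⟩ := h
    refine le_trans (Real.sqrt_le_sqrt (hm.trans ?_))
      (le_ciSup (f := fun m => √(μ m * r m * coSize d m / d m)) (Set.finite_range _).bddAbove m)
    rw [mul_div_assoc, mul_div_assoc]
    have h2 : 0 ≤ coSize d m / d m :=
      div_nonneg (Finset.prod_nonneg fun k _ => (hd k).le) (hd m).le
    have h3 : (r m : ℝ) ≤ μ m * r m := le_mul_of_one_le_left (Nat.cast_nonneg _) (hμ m)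
    exact mul_le_mul_of_nonneg_right h3 h2
  rcases le_or_gt (d n : ℝ) (coSize d n) with hle | hlt
  · exact ⟨n, by rw [le_div_iff₀ (hd n)]; gcongr⟩
  · obtain ⟨m, hm⟩ := hne
    refine ⟨m, ?_⟩
    have hnm : n ∈ Finset.univ.erase m := by
      simpa using (Finset.ne_of_mem_erase hm).symm
    set D := ∏ k ∈ (Finset.univ.erase n).erase m, (d k : ℝ) with hD
    have e1 : coSize d m = d n * D := by
      rw [coSize, ← Finset.mul_prod_erase _ _ hnm, hD, Finset.erase_right_comm]
    have e2 : coSize d n = d m * D := by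
      rw [coSize, ← Finset.mul_prod_erase _ _ hm]
    have hD1 : 1 ≤ D := Finset.one_le_prod fun k _ => hd1 k
    have hdm : (d m : ℝ) ≤ d n := by
      have : (d m : ℝ) ≤ d m * D := le_mul_of_one_le_right (hd m).le hD1
      linarith
    have h1 : (r n : ℝ) ≤ r m * D := by
      refine hprod.trans ?_
      rw [← Finset.mul_prod_erase _ _ hm]
      exact mul_le_mul_of_nonneg_left (Finset.prod_le_prod (fun k _ => Nat.cast_nonneg _)
        fun k _ => Nat.cast_le.2 (hrd k)) (Nat.cast_nonneg _)
    rw [e1, le_div_iff₀ (hd m)]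
    calc (r n : ℝ) * d m ≤ (r m * D) * d n := by gcongr
      _ = r m * (d n * D) := by ring

end Incoherence

/-! ### Constants in the failure probability. -/

section Numerics

/-- For `log α ≤ 3` take `b = log α` and use `α ≥ 1 + log α + (log α)²/2`; beyond that the growth
hypothesis allows `b = 3`, and `α ≥ 17/2`. The value `33/10` is what remains of the exponent: `1 -
1/400 - 3/4 = (3/40)(33/10)`. -/
theorem exists_exponent {α logJ ℓ : ℝ} (hα : 1 ≤ α) (hJℓ : logJ ≤ ℓ)
    (h3 : Real.log α * logJ ≤ 3 * ℓ) :
    ∃ b, Real.log α * logJ ≤ b * ℓ ∧ 20 / (9 * α) + b ≤ 33 / 10 := by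
  have hα0 : 0 < α := by linarith
  have ha : 0 ≤ Real.log α := Real.log_nonneg hα
  rcases le_or_gt (Real.log α) 3 with hle | hgt
  · refine ⟨Real.log α, mul_le_mul_of_nonneg_left hJℓ ha, ?_⟩
    have h1 := Real.quadratic_le_exp_of_nonneg ha
    rw [Real.exp_log hα0] at h1
    set a := Real.log α
    have h2 : 20 / (9 * α) ≤ 20 / (9 * (1 + a + a ^ 2 / 2)) := by gcongr
    have h4 : 20 / (9 * (1 + a + a ^ 2 / 2)) ≤ 33 / 10 - a := by
      rw [div_le_iff₀ (by positivity)]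
      nlinarith [mul_nonneg ha (sub_nonneg.2 hle), mul_nonneg (mul_nonneg ha ha) (sub_nonneg.2 hle)]
    linarith
  · refine ⟨3, h3, ?_⟩
    have h1 := Real.quadratic_le_exp_of_nonneg (by norm_num : (0 : ℝ) ≤ 3)
    have h2 : Real.exp 3 ≤ α := by
      rw [← Real.exp_log hα0]; exact Real.exp_le_exp.2 hgt.le
    have h4 : 20 / (9 * α) ≤ 20 / (9 * (17 / 2)) := by
      gcongr; linarith
    norm_num at h4 ⊢
    linarith

theorem exp_neg_six_le : Real.exp (-6) ≤ 1 / 400 := by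
  have h : (400 : ℝ) ≤ Real.exp 6 := by
    have h1 := Real.exp_one_gt_d9
    have h2 : Real.exp 6 = Real.exp 1 ^ 6 := by rw [← Real.exp_nat_mul]; norm_num
    rw [h2]
    calc (400 : ℝ) ≤ 2.7182818283 ^ 6 := by norm_num
      _ ≤ _ := by gcongr
  rw [Real.exp_neg, one_div]
  gcongr

/-- The failure probability after the union bound over the rows. -/
theorem union_bound_le {I r J vol x α : ℝ} (hr1 : 1 ≤ r) (hrI : r ≤ I) (hJ : 1 ≤ J)
    (hIJ : I * J ≤ vol) (hα : 1 ≤ α) (hαJ : J ^ Real.log α ≤ vol ^ 3)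
    (hx : 40 / 3 * (Real.log (2 * vol) + 5) ≤ x) :
    I * (r * Real.exp (x / (6 * α) - x * (1 - Real.exp (-6)))) ≤ 2 / J ^ (10 + Real.log α) := by
  have hI1 : 1 ≤ I := hr1.trans hrI
  have hI0 : 0 < I := by linarith
  have hJ0 : 0 < J := by linarith
  have hvol0 : 0 < vol := (mul_pos hI0 hJ0).trans_le hIJ
  have hlI : 0 ≤ Real.log I := Real.log_nonneg hI1
  have hlr : Real.log r ≤ Real.log I := Real.log_le_log (by linarith) hrI
  have hlJ : 0 ≤ Real.log J := Real.log_nonneg hJ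
  have hlvol : Real.log I + Real.log J ≤ Real.log vol := by
    rw [← Real.log_mul hI0.ne' hJ0.ne']
    exact Real.log_le_log (mul_pos hI0 hJ0) hIJ
  have h3 : Real.log α * Real.log J ≤ 3 * Real.log vol := by
    have := Real.log_le_log (Real.rpow_pos_of_pos hJ0 _) hαJ
    rwa [Real.log_rpow hJ0, Real.log_pow] at this
  obtain ⟨b, hb1, hb2⟩ := exists_exponent hα (by linarith) h3
  rw [Real.log_mul two_ne_zero hvol0.ne'] at hx
  have hl2 : 0 ≤ Real.log 2 := Real.log_nonneg one_le_two
  -- Since `x ≥ (40/3) log vol`, this rate yields decay `(10 + b) log vol`. It pays for `(10 + log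
  -- α) log J` and, with its `10 log I`, for the prefactor `I r ≤ I²`.
  have hκ : 3 / 40 * (10 + b) ≤ 1 - Real.exp (-6) - 1 / (6 * α) := by
    have h6 := exp_neg_six_le
    have e : 20 / (9 * α) = 40 / 3 * (1 / (6 * α)) := by
      field_simp; norm_num
    rw [e] at hb2
    linarith
  have hκ0 : 0 ≤ 1 - Real.exp (-6) - 1 / (6 * α) := by
    have h6 := exp_neg_six_le
    have : 1 / (6 * α) ≤ 1 / 6 := by gcongr; linarith
    linarith
  have hxx : 40 / 3 * Real.log vol * (1 - Real.exp (-6) - 1 / (6 * α))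
      ≤ x * (1 - Real.exp (-6) - 1 / (6 * α)) :=
    mul_le_mul_of_nonneg_right (by linarith) hκ0
  have hxx2 : 40 / 3 * Real.log vol * (3 / 40 * (10 + b))
      ≤ 40 / 3 * Real.log vol * (1 - Real.exp (-6) - 1 / (6 * α)) :=
    mul_le_mul_of_nonneg_left hκ (by linarith)
  have hexp : Real.log I + Real.log r + (x / (6 * α) - x * (1 - Real.exp (-6)))
      ≤ -((10 + Real.log α) * Real.log J) := by
    have e : x / (6 * α) - x * (1 - Real.exp (-6))
        = -(x * (1 - Real.exp (-6) - 1 / (6 * α))) := by ring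
    rw [e]
    linarith
  have hr0 : 0 < r := by linarith
  calc I * (r * Real.exp (x / (6 * α) - x * (1 - Real.exp (-6))))
      = Real.exp (Real.log I + Real.log r + (x / (6 * α) - x * (1 - Real.exp (-6)))) := by
        rw [Real.exp_add, Real.exp_add, Real.exp_log hI0, Real.exp_log hr0]; ring
    _ ≤ Real.exp (-((10 + Real.log α) * Real.log J)) := Real.exp_le_exp.2 hexp
    _ = 1 / J ^ (10 + Real.log α) := by
        rw [Real.exp_neg, Real.rpow_def_of_pos hJ0, one_div, mul_comm]
    _ ≤ 2 / J ^ (10 + Real.log α) := by gcongr; norm_num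

end Numerics

/-! ### The update error on a good sample. -/

section Deterministic

open Matrix

variable {N : ℕ} {d r : Fin N → ℕ}

theorem mixed_orthonormal {n : Fin N} {Aold Anew : ∀ k, Matrix (Fin (d k)) (Fin (r k)) ℝ}
    (hAold : ∀ k, (Aold k)ᵀ * Aold k = 1) (hAnew : ∀ k, k < n → (Anew k)ᵀ * Anew k = 1)
    (k : Fin N) : (mixed n Aold Anew k)ᵀ * mixed n Aold Anew k = 1 := by
  unfold mixed
  split_ifs with h
  · exact hAnew k h
  · exact hAold k

open Classical in
/-- On a sample whose row-wise Gram matrices are at least `τ`, every sampled least-squares update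
is close to the full one. -/
theorem sq_norm_sub_le_of_gram {T : Tensor d} {Gstar : Tensor r}
    {Astar : ∀ k, Matrix (Fin (d k)) (Fin (r k)) ℝ}
    (hAstar : ∀ k, (Astar k)ᵀ * Astar k = 1) (hT : T = multiProd Gstar Astar)
    {n : Fin N} {G : Tensor r} {Aold Anew : ∀ k, Matrix (Fin (d k)) (Fin (r k)) ℝ}
    (hAold : ∀ k, (Aold k)ᵀ * Aold k = 1) (hAnew : ∀ k, k < n → (Anew k)ᵀ * Anew k = 1)
    {gmin : ℝ} (hgmin : 0 < gmin) (hG : gmin ≤ sigmaMin (unfold n G))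
    (hr : 0 < r n) (hcard : r n ≤ Fintype.card (CoIndex r n))
    {Xopt Xtilde : Matrix (Fin (d n)) (Fin (r n)) ℝ}
    (hXopt : IsMinOn (fun X => frobNorm (lsTensor n G Aold Anew X - T)) Set.univ Xopt)
    {S : Set (∀ k, Fin (d k))}
    (hXtilde : IsMinOn (fun X => frobNorm (proj S (lsTensor n G Aold Anew X) - proj S T))
      Set.univ Xtilde) {τ : ℝ} (hτ : 0 ≤ τ)
    (hgram : ∀ a, ∀ x : Fin (r n) → ℝ,
      τ * (((kronExcept n (mixed n Aold Anew) * (unfold n G)ᵀ) *ᵥ x) ⬝ᵥ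
        ((kronExcept n (mixed n Aold Anew) * (unfold n G)ᵀ) *ᵥ x))
      ≤ ∑ j with (Equiv.piSplitAt n fun k => Fin (d k)).symm (a, j) ∈ S,
        ((kronExcept n (mixed n Aold Anew) * (unfold n G)ᵀ) *ᵥ x) j ^ 2) :
    τ * gmin ^ 2 * ‖Xtilde - Xopt‖ ^ 2 ≤ r n *
      (sinThetaNorm (kronExcept n (mixed n Aold Anew) * (unfold n G)ᵀ)
        (kronExcept n Astar * (unfold n Gstar)ᵀ) ^ 2 * gMax T ^ 2) := by
  set W := kronExcept n (mixed n Aold Anew) * (unfold n G)ᵀ with hW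
  set V := kronExcept n Astar * (unfold n Gstar)ᵀ with hV
  have hTn : unfold n T = Astar n * Vᵀ := by rw [hT, unfold_multiProd]
  have hLn (X) : unfold n (lsTensor n G Aold Anew X) = X * Wᵀ := unfold_lsTensor n G Aold Anew X
  have : Nonempty (Fin (r n)) := ⟨⟨0, hr⟩⟩
  have hWlow (x : Fin (r n) → ℝ) : gmin ^ 2 * (x ⬝ᵥ x) ≤ (W *ᵥ x) ⬝ᵥ (W *ᵥ x) := by
    have h1 := sq_sigmaMin_mul_le (unfold n G) (by rwa [Fintype.card_fin]) x
    rw [hW, ← Matrix.mulVec_mulVec, mulVec_dotProduct_self_of_orthonormal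
      (kronExcept_orthonormal n fun k _ => mixed_orthonormal hAold hAnew k)]
    refine le_trans (mul_le_mul_of_nonneg_right (pow_le_pow_left₀ hgmin.le hG 2) ?_) h1
    exact Finset.sum_nonneg fun i _ => mul_self_nonneg _
  have hWinj (x : Fin (r n) → ℝ) (hx : W *ᵥ x = 0) : x = 0 := by
    have h1 := hWlow x
    rw [hx, dotProduct_zero] at h1
    have h2 : x ⬝ᵥ x ≤ 0 := by
      by_contra! h3
      have : 0 < gmin ^ 2 * (x ⬝ᵥ x) := by positivity
      linarith
    exact dotProduct_self_eq_zero.1 (le_antisymm h2 (Finset.sum_nonneg fun i _ => mul_self_nonneg _))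
  -- Injectivity of `W` gives its column space dimension `r n`, which that of `V` cannot exceed; the
  -- angle bound needs this comparison.
  have hrank : Module.finrank ℝ (colSpace V) ≤ Module.finrank ℝ (colSpace W) := by
    rw [finrank_colSpace_of_injective W hWinj]
    exact finrank_colSpace V
  have hfull := leastSquares_residual_le W V (Astar n) (hAstar n) hrank (X₀ := Xopt) fun X => by
    have h1 := pow_le_pow_left₀ (Real.sqrt_nonneg _) (isMinOn_iff.1 hXopt X (Set.mem_univ _)) 2
    have h2 := frobNorm_sq (lsTensor n G Aold Anew Xopt - T) n
    have h3 := frobNorm_sq (lsTensor n G Aold Anew X - T) n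
    have h4 (X) (a) (j) : unfold n (lsTensor n G Aold Anew X - T) a j
        = (X * Wᵀ) a j - (Astar n * Vᵀ) a j := by
      rw [← hTn, ← hLn]; rfl
    simp only [h4] at h2 h3
    rw [← h2, ← h3]
    exact h1
  have hsamp := sampled_leastSquares_le W (Astar n * Vᵀ)
    (fun a => {j | (Equiv.piSplitAt n fun k => Fin (d k)).symm (a, j) ∈ S})
    (X₀ := Xopt) (X₁ := Xtilde) (fun X => by
      have h1 := pow_le_pow_left₀ (Real.sqrt_nonneg _)
        (isMinOn_iff.1 hXtilde X (Set.mem_univ _)) 2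
      have h2 := frobNorm_proj_sub_sq S (lsTensor n G Aold Anew Xtilde) T n
      have h3 := frobNorm_proj_sub_sq S (lsTensor n G Aold Anew X) T n
      rw [hLn, hTn] at h2 h3
      rw [← h2, ← h3]
      exact h1) hgram
  have hgMax : ‖Astar n * Vᵀ‖ ≤ gMax T := by
    rw [← hTn]
    exact le_ciSup (f := fun k => ‖unfold k T‖) (Set.finite_range _).bddAbove n
  calc τ * gmin ^ 2 * ‖Xtilde - Xopt‖ ^ 2
      ≤ τ * gmin ^ 2 * ∑ i, ∑ j, (Xtilde - Xopt) i j ^ 2 := by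
        gcongr
        exact sq_norm_le_sum_sq _
    _ = τ * ∑ i, gmin ^ 2 * ((Xtilde - Xopt) i ⬝ᵥ (Xtilde - Xopt) i) := by
        rw [← Finset.mul_sum, mul_assoc]
        simp only [dotProduct, sq]
    _ ≤ τ * ∑ i, (W *ᵥ (Xtilde - Xopt) i) ⬝ᵥ (W *ᵥ (Xtilde - Xopt) i) := by
        gcongr with i
        exact hWlow _
    _ ≤ _ := hsamp.trans hfull
    _ ≤ _ := by
        rw [Fintype.card_fin]
        gcongr

end Deterministic

end TuckerALS

/-! ### The main estimate. -/

open TuckerALS MeasureTheory ProbabilityTheory Matrix in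
theorem lemma4p1 {N : ℕ} (d r : Fin N → ℕ)
    -- the tensor and its exact factorization
    (T : Tensor d) (Gstar : Tensor r) (Astar : ∀ k, Matrix (Fin (d k)) (Fin (r k)) ℝ)
    (hAstar : ∀ k, (Astar k)ᵀ * Astar k = 1)
    (hGstar : ∀ k, (unfold k Gstar).rank = r k)
    (hT : T = multiProd Gstar Astar)
    -- the current estimates when mode `n` is about to be updated
    (n : Fin N) (G : Tensor r) (Aold Anew : ∀ k, Matrix (Fin (d k)) (Fin (r k)) ℝ)
    (hAold : ∀ k, (Aold k)ᵀ * Aold k = 1)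
    (hAnew : ∀ k, k < n → (Anew k)ᵀ * Anew k = 1)
    -- incoherence
    (μ : Fin N → ℝ)
    (hμold : ∀ k, twoInfNorm (Aold k) ≤ √(μ k * r k / d k))
    (hμnew : ∀ k, k < n → twoInfNorm (Anew k) ≤ √(μ k * r k / d k))
    -- singular values of the core
    (gmin : ℝ) (hgmin : 0 < gmin) (hG : ∀ k, gmin ≤ sigmaMin (unfold k G))
    -- the subspace-angle condition
    (C : ℝ) (hC : 0 < C)
    (hangle : sinThetaNorm (kronExcept n (mixed n Aold Anew) * (unfold n G)ᵀ)
        (kronExcept n Astar * (unfold n Gstar)ᵀ) ≤ C * maxSin Aold Astar)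
    -- each entry is observed independently with probability `p`
    {Ω : Type*} [MeasurableSpace Ω] (P : Measure Ω) [IsProbabilityMeasure P]
    (p : ℝ) (hp : p ∈ Set.Icc (4 * pStar d r μ) (1 / 2))
    (obs : (∀ k, Fin (d k)) → Set Ω) (hobs : ∀ i, MeasurableSet (obs i))
    (hindep : iIndepSet obs P) (hprob : ∀ i, P (obs i) = ENNReal.ofReal p)
    -- the deviation parameter
    (α : ℝ) (hα : 1 ≤ α)
    (hαJ : coSizeMin d ^ Real.log α ≤ (∏ k, (d k : ℝ)) ^ 3)
    -- the fully observed least-squares update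
    (Xopt : Matrix (Fin (d n)) (Fin (r n)) ℝ)
    (hXopt : IsMinOn (fun X => frobNorm (lsTensor n G Aold Anew X - T)) Set.univ Xopt) :
    1 - 2 / coSizeMin d ^ (10 + Real.log α) ≤
      P.real {ω | ∀ Xtilde : Matrix (Fin (d n)) (Fin (r n)) ℝ,
        IsMinOn (fun X => frobNorm (proj {i | ω ∈ obs i} (lsTensor n G Aold Anew X)
          - proj {i | ω ∈ obs i} T)) Set.univ Xtilde →
        ‖Xtilde - Xopt‖ ≤
          6 * gMax T * (constOne d r μ C (gMax T) gmin + constTwo d r μ C) / gmin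
            * √(α / p) * maxSin Aold Astar} := by
  classical
  have hr (k) : 0 < r k := by
    rcases Nat.eq_zero_or_pos (r k) with h | h
    · have : IsEmpty (Fin (r k)) := by rw [h]; infer_instance
      have := hG k
      rw [sigmaMin_eq_zero_of_isEmpty] at this
      linarith
    · exact h
  have hrd (k) : r k ≤ d k := card_le_card_of_orthonormal (hAold k)
  have hd1 (k) : (1 : ℝ) ≤ d k := by exact_mod_cast (hr k).trans_le (hrd k)
  have hd0 (k) : (0 : ℝ) < d k := zero_lt_one.trans_le (hd1 k)
  have hr0 (k) : (0 : ℝ) < r k := by exact_mod_cast hr k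
  have hμ1 (k) : 1 ≤ μ k := one_le_of_twoInfNorm_le (hAold k) (hr k) (hμold k)
  have hx0 (k) : 0 < μ k * r k / d k :=
    div_pos (mul_pos (zero_lt_one.trans_le (hμ1 k)) (hr0 k)) (hd0 k)
  -- Full row rank of the true core's unfolding forces at least `r n` columns; hence `sigmaMin` of
  -- `unfold n G` has index `r n - 1` and bounds `W` below.
  have hcard : r n ≤ Fintype.card (CoIndex r n) := by
    rw [← hGstar n]; exact Matrix.rank_le_card_width _
  set vol := ∏ k, (d k : ℝ) with hvol
  have hvol1 : 1 ≤ vol := Finset.one_le_prod fun k _ => hd1 k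
  set ν := ∏ k : {k // k ≠ n}, μ k * r k / d k with hν
  have hν0 : 0 < ν := Finset.prod_pos fun k _ => hx0 k
  have hlog : 0 ≤ Real.log (2 * vol) := Real.log_nonneg (by linarith)
  have hpν : 40 / 3 * (Real.log (2 * vol) + 5) * ν ≤ p := by
    refine le_trans ?_ hp.1
    rw [pStar, hν, prod_subtype_ne n fun k => μ k * r k / d k, ← hvol]
    have := le_ciSup (f := fun m => ∏ k ∈ Finset.univ.erase m, μ k * r k / d k)
      (Set.finite_range _).bddAbove n
    have := mul_le_mul_of_nonneg_left this
      (by positivity : 0 ≤ 40 / 3 * (Real.log (2 * vol) + 5))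
    linarith
  have hp0 : 0 < p := lt_of_lt_of_le (by positivity) hpν
  have hp1 : p ≤ 1 := hp.2.trans (by norm_num)
  -- With a single mode the empty product gives `ν = 1`, so `p ≥ 200/3`, against `p ≤ 1/2`.
  have hne : (Finset.univ.erase n).Nonempty := by
    rw [Finset.nonempty_iff_ne_empty]
    intro he
    rw [hν, prod_subtype_ne n fun k => μ k * r k / d k, he, Finset.prod_empty] at hpν
    have := hp.2
    linarith
  have hco (k) : 1 ≤ coSize d k := Finset.one_le_prod fun k _ => hd1 k
  have hNe : Nonempty (Fin N) := ⟨n⟩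
  have hJ1 : 1 ≤ coSizeMin d := le_ciInf hco
  have hJn : coSizeMin d ≤ coSize d n := ciInf_le (Set.finite_range _).bddBelow n
  have hIJ : d n * coSizeMin d ≤ vol := by
    rw [hvol, ← Finset.mul_prod_erase _ _ (Finset.mem_univ n)]
    exact mul_le_mul_of_nonneg_left hJn (hd0 n).le
  have hα0 : 0 < α := by linarith
  have hrow (j : CoIndex d n) : kronExcept n (mixed n Aold Anew) j ⬝ᵥ
      kronExcept n (mixed n Aold Anew) j ≤ ν := by
    refine kronExcept_row n _ (x := fun k => μ k * r k / d k) (fun k _ i => ?_) j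
    rw [← Real.sq_sqrt (hx0 k).le]
    unfold mixed
    split_ifs with h
    · exact sum_sq_row_le_of_twoInfNorm_le (hμnew k h) i
    · exact sum_sq_row_le_of_twoInfNorm_le (hμold k) i
  set W := kronExcept n (mixed n Aold Anew) * (unfold n G)ᵀ with hW
  set e := (Equiv.piSplitAt n fun k => Fin (d k)).symm with he
  -- The square root of `1/τ` is the factor `6 √(α/p)` of the conclusion.
  set τ := p / (36 * α) with hτ
  have hτ0 : 0 < τ := by positivity
  let bad : Fin (d n) → Set Ω := fun a => {ω | ¬ ∀ x : Fin (r n) → ℝ,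
    τ * ((W *ᵥ x) ⬝ᵥ (W *ᵥ x)) ≤ ∑ j with ω ∈ obs (e (a, j)), (W *ᵥ x) j ^ 2}
  have hbad (a) : P.real (bad a)
      ≤ r n * Real.exp (p / ν / (6 * α) - p / ν * (1 - Real.exp (-6))) := by
    have hinj : Function.Injective fun j => e (a, j) := fun j j' h =>
      (Prod.ext_iff.1 (e.injective h)).2
    -- The choice `θ = 6/ν` gives the exponent `p/(6αν) - (p/ν)(1 - e^{-6})`.
    have := measureReal_gram_lt_le (obs := fun j => obs (e (a, j))) (fun j => hobs _)
      (hindep.precomp hinj) hp0.le hp1 (fun j => hprob _)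
      (kronExcept_orthonormal n fun k _ => mixed_orthonormal hAold hAnew k) hν0 hrow
      (unfold n G)ᵀ (θ := 6 / ν) (by positivity) τ
    rw [Fintype.card_fin, div_mul_cancel₀ _ hν0.ne'] at this
    refine this.trans_eq ?_
    congr 2
    rw [hτ]
    field_simp
    ring
  have hunion : P.real (⋃ a, bad a) ≤ 2 / coSizeMin d ^ (10 + Real.log α) := by
    refine (measureReal_iUnion_fintype_le _).trans ((Finset.sum_le_sum fun a _ => hbad a).trans ?_)
    rw [Finset.sum_const, Finset.card_univ, Fintype.card_fin, nsmul_eq_mul]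
    refine union_bound_le (by exact_mod_cast hr n) (by exact_mod_cast hrd n) hJ1 hIJ hα hαJ ?_
    rwa [le_div_iff₀ hν0]
  have hsub : (⋃ a, bad a)ᶜ ⊆ {ω | ∀ Xtilde : Matrix (Fin (d n)) (Fin (r n)) ℝ,
        IsMinOn (fun X => frobNorm (proj {i | ω ∈ obs i} (lsTensor n G Aold Anew X)
          - proj {i | ω ∈ obs i} T)) Set.univ Xtilde →
        ‖Xtilde - Xopt‖ ≤
          6 * gMax T * (constOne d r μ C (gMax T) gmin + constTwo d r μ C) / gmin
            * √(α / p) * maxSin Aold Astar} := by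
    intro ω hω Xtilde hXtilde
    have hgram : ∀ a, ∀ x : Fin (r n) → ℝ,
        τ * ((W *ᵥ x) ⬝ᵥ (W *ᵥ x)) ≤ ∑ j with ω ∈ obs (e (a, j)), (W *ᵥ x) j ^ 2 := by
      simpa [bad] using hω
    have key := sq_norm_sub_le_of_gram hAstar hT hAold hAnew hgmin (hG n) (hr n) hcard hXopt
      hXtilde hτ0.le (by convert! hgram)
    rw [← hW] at key
    set s := sinThetaNorm W (kronExcept n Astar * (unfold n Gstar)ᵀ)
    have hs0 : 0 ≤ s := sinThetaNorm_nonneg _ _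
    have hg0 : 0 ≤ gMax T := Real.iSup_nonneg fun k => norm_nonneg _
    have hsin0 : 0 ≤ maxSin Aold Astar := Real.iSup_nonneg fun k => sinThetaNorm_nonneg _ _
    have hsq : √(r n) ≤ ⨆ m, √(μ m * r m * coSize d m / d m) :=
      sqrt_le_iSup_sqrt hμ1 hr hrd (by rw [← card_coIndex]; exact_mod_cast hcard) hne
    have hC1 : 0 ≤ constOne d r μ C (gMax T) gmin := by
      refine mul_nonneg (by positivity) (Real.iSup_nonneg fun m => ?_)
      exact mul_nonneg (Real.sqrt_nonneg _) (Finset.prod_nonneg fun k _ => Real.sqrt_nonneg _)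
    have h1 : ‖Xtilde - Xopt‖ ≤ 6 * gMax T * √(r n) / gmin * √(α / p) * s := by
      refine le_of_sq_le_sq ?_ (by positivity)
      have e2 : (6 * gMax T * √(r n) / gmin * √(α / p) * s) ^ 2
          = r n * (s ^ 2 * gMax T ^ 2) / (τ * gmin ^ 2) := by
        simp only [mul_pow, div_pow]
        rw [Real.sq_sqrt (hr0 n).le, Real.sq_sqrt (by positivity), hτ]
        field_simp
        ring
      rw [e2, le_div_iff₀ (by positivity)]
      linarith
    calc ‖Xtilde - Xopt‖ ≤ 6 * gMax T * √(r n) / gmin * √(α / p) * s := h1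
      _ ≤ 6 * gMax T * (⨆ m, √(μ m * r m * coSize d m / d m)) / gmin * √(α / p)
          * (C * maxSin Aold Astar) := by
        have : 0 ≤ ⨆ m, √(μ m * r m * coSize d m / d m) := (Real.sqrt_nonneg _).trans hsq
        gcongr
      _ = 6 * gMax T * constTwo d r μ C / gmin * √(α / p) * maxSin Aold Astar := by
          rw [constTwo]; ring
      -- Only `C₂` has been needed so far; adding `C₁ ≥ 0` weakens the bound.
      _ ≤ _ := by
          gcongr
          linarith
  -- Subadditivity gives this without measurability of the bad event.
  have hcompl : 1 - P.real (⋃ a, bad a) ≤ P.real (⋃ a, bad a)ᶜ := by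
    have := measureReal_union_le (μ := P) (⋃ a, bad a) (⋃ a, bad a)ᶜ
    rw [Set.union_compl_self, probReal_univ] at this
    linarith
  linarith [measureReal_mono (μ := P) hsub]
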